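/- There is a universal constant $C>0$ such that the following two statements hold. Write $v=(v^x,v^y)$ for the components of a vector field on $\mathbb{R}^2$, $|v|$ for its Euclidean norm, $a^+=\max\{a,0\}$ and $a^-=\max\{-a,0\}$. (1) Let $S,T\in W^{1,1}(\mathbb{R}^2,\mathbb{R}^2)$ satisfy $S^x\ge 0$ and $T^y\ge 0$ almost everywhere, and let $\chi:\mathbb{R}^2\to[0,1]$ be a Borel function supported in a bounded set. Put $$S^P:=(S^x-|S^y|)^+,\quad S^N:=(S^x-|S^y|)^-,\quad T^P:=(T^y-|T^x|)^+,\quad T^N:=(T^y-|T^x|)^-.$$ Then $$\int_{\mathbb{R}^2}\chi\,\min\{S^P,T^P\}\le C\,\|\chi\|_{L^2}\Big[\int_{\mathbb{R}^2}(|S|+|\operatorname{div}S|)\Big]^{1/2}\Big[\int_{\mathbb{R}^2}(|T|+|\operatorname{div}T|)\Big]^{1/2}+\int_{\mathbb{R}^2}\big(C|\operatorname{div}S|+C|\operatorname{div}T|+S^N+T^N\big).$$ (2) The same inequality holds, for every such $\chi$, if $S=(S^x,S^y)$ and $T=(T^x,T^y)$ are $\mathbb{R}^2$-valued Borel measures on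 $\mathbb{R}^2$ with finite total variation, whose distributional divergences $\operatorname{div}S$, $\operatorname{div}T$ are real-valued Borel measures with finite total variation, and $S^x\ge0$, $T^y\ge0$ as measures. Here $|\mu|$ denotes the total variation measure (for $\mathbb{R}^2$-valued $\mu$, with respect to the Euclidean norm), $\int_{\mathbb{R}^2}|\mu|$ means $|\mu|(\mathbb{R}^2)$, the measures $S^P,S^N,T^P,T^N$ are defined by the same formulas, where $(\cdot)^+$ and $(\cdot)^-$ are the positive and negative parts in the Jordan decomposition, $\min\{\mu,\nu\}:=\tfrac12(\mu+\nu-|\mu-\nu|)$, and $\|\chi\|_{L^2}$ is taken with respect to Lebesgue measure. -/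

import Mathlib

open MeasureTheory
open scoped ContDiff

noncomputable section

namespace PlaneFields

/-- The Euclidean plane; the coordinates `x`, `y` are the indices `0`, `1`. -/
abbrev Plane : Type := EuclideanSpace ℝ (Fin 2)

/-- The classical partial derivative `∂ᵢ φ`. -/
def partialDeriv (i : Fin 2) (φ : Plane → ℝ) (p : Plane) : ℝ :=
  fderiv ℝ φ p (EuclideanSpace.single i 1)

/-- Test functions: the elements of `C_c^∞(ℝ²)`. -/
def IsTestFunction (φ : Plane → ℝ) : Prop :=
  ContDiff ℝ ∞ φ ∧ HasCompactSupport φ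

/-! ### Sobolev vector fields -/

/-- `v` is a weak `i`-th partial derivative of `u`: both are locally integrable and
`∫ u ∂ᵢφ = - ∫ v φ` for every test function `φ`. -/
structure HasWeakPartial (i : Fin 2) (u v : Plane → ℝ) : Prop where
  locallyIntegrable_left : LocallyIntegrable u volume
  locallyIntegrable_right : LocallyIntegrable v volume
  integral_eq : ∀ φ : Plane → ℝ, IsTestFunction φ →
    ∫ p, u p * partialDeriv i φ p = - ∫ p, v p * φ p

/-- The Sobolev space `W^{1,1}(ℝ²,ℝ²)`: integrable fields all of whose components have integrable
weak partial derivatives. -/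
def MemW11 (S : Plane → Plane) : Prop :=
  Integrable S volume ∧
    ∀ i j : Fin 2, ∃ v : Plane → ℝ, Integrable v volume ∧ HasWeakPartial i (fun p => S p j) v

open Classical in
/-- The weak partial derivative of `u`, which is unique up to almost everywhere equality
(and `0` when `u` has none). -/
def weakPartial (i : Fin 2) (u : Plane → ℝ) : Plane → ℝ :=
  if h : ∃ v, HasWeakPartial i u v then h.choose else 0

/-- The divergence `∂ₓ S^x + ∂_y S^y` of a Sobolev field. -/
def weakDiv (S : Plane → Plane) (p : Plane) : ℝ :=
  weakPartial 0 (fun q => S q 0) p + weakPartial 1 (fun q => S q 1) p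

/-! ### Real-valued measures -/

/-- `|μ|`, as a real-valued measure. -/
def absMeas (μ : SignedMeasure Plane) : SignedMeasure Plane :=
  μ.totalVariation.toSignedMeasure

/-- The positive part `μ⁺` of the Jordan decomposition, as a real-valued measure. -/
def posMeas (μ : SignedMeasure Plane) : SignedMeasure Plane :=
  μ.toJordanDecomposition.posPart.toSignedMeasure

/-- The negative part `μ⁻ ≥ 0` of the Jordan decomposition, as a real-valued measure. -/
def negMeas (μ : SignedMeasure Plane) : SignedMeasure Plane :=
  μ.toJordanDecomposition.negPart.toSignedMeasure

/-- `min{μ,ν} = (μ + ν - |μ - ν|) / 2`. -/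
def minMeas (μ ν : SignedMeasure Plane) : SignedMeasure Plane :=
  (1 / 2 : ℝ) • (μ + ν - absMeas (μ - ν))

/-- The `i`-th component of an `ℝ²`-valued measure. -/
def comp (S : VectorMeasure Plane Plane) (i : Fin 2) : SignedMeasure Plane :=
  S.mapRange (EuclideanSpace.proj i : Plane →L[ℝ] ℝ).toLinearMap.toAddMonoidHom
    (EuclideanSpace.proj i : Plane →L[ℝ] ℝ).continuous

/-- The real-valued measure `δ` is the distributional divergence of the `ℝ²`-valued measure `S`. -/
def HasDivergence (S : VectorMeasure Plane Plane) (δ : SignedMeasure Plane) : Prop :=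
  ∀ φ : Plane → ℝ, IsTestFunction φ →
    (∫ᵛ p, partialDeriv 0 φ p ∂<•(comp S 0)) + (∫ᵛ p, partialDeriv 1 φ p ∂<•(comp S 1))
      = - ∫ᵛ p, φ p ∂<•δ

end PlaneFields

end

/-!
If `S` is divergence free it has a stream function `f`, with `∂_y f = S^x` and `∂ₓ f = -S^y`;
likewise `T` has one, `g`, with `∂ₓ g = T^y` and `∂_y g = -T^x`. Where
`S^x > |S^y|` and `T^y > |T^x|` the Jacobian of `(f, g)` is at least
`(S^x - |S^y|) (T^y - |T^x|) ≥ min {S^P, T^P} ^ 2`. If moreover `(f, g)` is injective, the integral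
of the Jacobian over a unit square is at most the area of the image, which is bounded by the product
of the oscillations of `f` and `g`, hence by the product of the masses of `S` and `T` nearby.
The Cauchy-Schwarz inequality then gives the estimate on a unit square, and a summation over the
squares of a grid gives it on the plane.

Three things stand in the way of this argument.

* The divergence does not vanish. On a unit square, `exists_stream_function` produces `f` with
  `∂_y f = S^x` exactly and `|∂ₓ f + S^y|` bounded in mean by `|div S|`. The oscillation of `f` is
  controlled by the flux of `S` through a vertical segment, `flux_le`.
* `(f, g)` need not be injective, since `S^x > |S^y|` can fail. Because `∂_y f > 0`, the level sets
  of `f` are graphs over the `x`-axis, and the rising sun lemma on each of them,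
  `setIntegral_sub_abs_deriv_nonpos`, shows that after discarding a set on which the integral of
  `∂_y f - |∂ₓ f|` is essentially nonpositive, any two points on a common level set see each other
  under slope less than `1` (`exists_selection`). On the discarded set the integral of `S^P` is at
  most that of `S^N`, up to the divergence. With the same selection for `g` and the axes exchanged,
  two points with the same values of `f` and `g` coincide. This is carried out in
  `square_estimate_aux`, with a small parameter `ε` which makes `f` strictly monotone in `y` and the
  slopes strictly less than `1`, and tends to `0` in the end.
* The fields are not smooth. Sobolev fields and vector measures are treated together, as fields with
  integrable densities with respect to a common measure `m`, which is the Lebesgue measure in the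
  first case and the sum of all the total variations in the second. Mollification does not increase
  the terms on the right, and on the left `min (S^x - |S^y|) (T^y - |T^x|)` is a concave function of
  the fields, so its mollification is a lower bound (`estimate_mollified`). Borel cutoffs are
  approximated by continuous ones with respect to Lebesgue measure and `m` at the same time
  (`density_estimate`).
-/

noncomputable section

namespace PlaneFields

open Set Filter Topology NNReal

/-! ### A two-sided rising sun lemma -/

/-- The right difference quotients of `ψ` being dominated by those of `u` gives the same domination
for the derivatives. -/
theorem deriv_le_abs_deriv_sub {ψ u : ℝ → ℝ} {l x : ℝ} (hψ : DifferentiableAt ℝ ψ x)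
    (hu : DifferentiableAt ℝ u x)
    (h : ∀ᶠ z in 𝓝[>] x, ψ z ≤ ψ x + |u z - u x| - l * (z - x)) :
    deriv ψ x ≤ |deriv u x| - l := by
  have h1 := hψ.hasDerivAt.hasDerivWithinAt (s := Ioi x)
  have h2 := hu.hasDerivAt.hasDerivWithinAt (s := Ioi x)
  rw [hasDerivWithinAt_iff_tendsto_slope' (by simp)] at h1 h2
  refine le_of_tendsto_of_tendsto h1 (h2.abs.sub_const l) ?_
  filter_upwards [h, self_mem_nhdsWithin] with z hz hzx
  have hzx' : 0 < z - x := sub_pos.2 hzx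
  rw [slope_def_field, slope_def_field, abs_div, abs_of_pos hzx', div_le_iff₀ hzx', sub_mul,
    div_mul_cancel₀ _ hzx'.ne']
  linarith

/-- A two-sided version of the rising sun lemma: on the set of points from which `u` looks steeper
than `l` in some leftward chord, the average of `|u'|` is at least `l`. The proof compares `u` with
the largest excess `ψ x` of such a chord ending at `x`, which is a nonnegative Lipschitz function
with `ψ' ≤ |u'| - l` wherever it is positive. -/
theorem setIntegral_sub_abs_deriv_nonpos {u : ℝ → ℝ} {a b l : ℝ} {K : ℝ≥0} (hab : a ≤ b)
    (hl : 0 ≤ l) (hu : LipschitzOnWith K u (Icc a b)) :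
    ∫ x in {x ∈ Ioo a b | ∃ t ∈ Icc a x, l * (x - t) < |u x - u t|}, (l - |deriv u x|) ≤ 0 := by
  have hmax : ∀ x ∈ Icc a b, ∃ t ∈ Icc a x, IsMaxOn (fun t => |u x - u t| - l * (x - t))
      (Icc a x) t := by
    intro x hx
    refine isCompact_Icc.exists_isMaxOn ⟨x, hx.1, le_rfl⟩ ?_
    have : ContinuousOn u (Icc a x) := hu.continuousOn.mono (Icc_subset_Icc_right hx.2)
    fun_prop
  choose! τ hτ hτmax using hmax
  set ψ : ℝ → ℝ := fun x => |u x - u (τ x)| - l * (x - τ x) with hψdef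
  have hψge : ∀ x ∈ Icc a b, ∀ t ∈ Icc a x, |u x - u t| - l * (x - t) ≤ ψ x := fun x hx t ht =>
    hτmax x hx ht
  have hψ0 : ∀ x ∈ Icc a b, 0 ≤ ψ x := fun x hx => by
    simpa using hψge x hx x ⟨hx.1, le_rfl⟩
  have hK : ∀ x ∈ Icc a b, ∀ z ∈ Icc a b, x ≤ z → |u z - u x| ≤ K * (z - x) := by
    intro x hx z hz hxz
    have := hu.dist_le_mul z hz x hx
    rwa [Real.dist_eq, Real.dist_eq, abs_of_nonneg (sub_nonneg.2 hxz)] at this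
  have hKn : (0 : ℝ) ≤ K := K.2
  have hlow : ∀ x ∈ Icc a b, ∀ z ∈ Icc a b, x ≤ z → ψ x - (K + l) * (z - x) ≤ ψ z := by
    intro x hx z hz hxz
    have h1 := hψge z hz (τ x) ⟨(hτ x hx).1, (hτ x hx).2.trans hxz⟩
    have h2 : |u x - u (τ x)| ≤ |u z - u (τ x)| + |u z - u x| := by
      have := abs_sub_le (u x) (u z) (u (τ x)); rw [abs_sub_comm (u x) (u z)] at this; linarith
    have h3 := hK x hx z hz hxz
    simp only [hψdef] at h1 ⊢
    linarith
  -- the optimal chord ending at `z` starts either before `x`, or in `[x, z]`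
  have hup : ∀ x ∈ Icc a b, ∀ z ∈ Icc a b, x ≤ z →
      ψ z ≤ ψ x + |u z - u x| - l * (z - x) ∨ ψ z ≤ K * (z - x) := by
    intro x hx z hz hxz
    rcases le_total (τ z) x with ht | ht
    · left
      have h1 := hψge x hx (τ z) ⟨(hτ z hz).1, ht⟩
      have h2 := abs_sub_le (u z) (u x) (u (τ z))
      simp only [hψdef] at h1 ⊢
      linarith
    · right
      have h1 := hK (τ z) ⟨(hτ z hz).1, (hτ z hz).2.trans hz.2⟩ z hz (hτ z hz).2
      have h2 : K * (z - τ z) ≤ K * (z - x) := by gcongr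
      have h3 : 0 ≤ l * (z - τ z) := mul_nonneg hl (sub_nonneg.2 (hτ z hz).2)
      simp only [hψdef]
      linarith
  have hup' : ∀ x ∈ Icc a b, ∀ z ∈ Icc a b, x ≤ z → ψ z ≤ ψ x + K * (z - x) := by
    intro x hx z hz hxz
    have h0 := hψ0 x hx
    have h1 := hK x hx z hz hxz
    have h2 : 0 ≤ l * (z - x) := mul_nonneg hl (sub_nonneg.2 hxz)
    rcases hup x hx z hz hxz with h | h <;> linarith
  have hψlip : LipschitzOnWith (K + l.toNNReal) ψ (Icc a b) := by
    have key : ∀ x ∈ Icc a b, ∀ z ∈ Icc a b, x ≤ z → |ψ z - ψ x| ≤ (K + l) * (z - x) := by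
      intro x hx z hz hxz
      have h1 := hlow x hx z hz hxz
      have h2 := hup' x hx z hz hxz
      have h3 : 0 ≤ l * (z - x) := mul_nonneg hl (sub_nonneg.2 hxz)
      rw [abs_le]; constructor <;> linarith
    refine LipschitzOnWith.of_dist_le_mul fun x hx z hz => ?_
    rw [NNReal.coe_add, Real.coe_toNNReal _ hl, Real.dist_eq, Real.dist_eq]
    rcases le_total x z with h | h
    · rw [abs_sub_comm, abs_sub_comm x z, abs_of_nonneg (sub_nonneg.2 h)]
      exact key x hx z hz h
    · rw [abs_of_nonneg (sub_nonneg.2 h)]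
      exact key z hz x hx h
  have hE : {x ∈ Ioo a b | ∃ t ∈ Icc a x, l * (x - t) < |u x - u t|} = Ioo a b ∩ {x | 0 < ψ x} := by
    ext x
    constructor
    · rintro ⟨hx, t, ht, h⟩
      have := hψge x (Ioo_subset_Icc_self hx) t ht
      exact ⟨hx, by simp only [mem_ofPred_eq]; linarith⟩
    · rintro ⟨hx, h⟩
      refine ⟨hx, τ x, hτ x (Ioo_subset_Icc_self hx), ?_⟩
      simp only [hψdef, mem_ofPred_eq] at h
      linarith
  rw [hE]
  set E := Ioo a b ∩ {x | 0 < ψ x} with hEdef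
  have hEo : IsOpen E :=
    (hψlip.continuousOn.mono Ioo_subset_Icc_self).isOpen_inter_preimage isOpen_Ioo isOpen_Ioi
  have hψac : AbsolutelyContinuousOnInterval ψ a b :=
    LipschitzOnWith.absolutelyContinuousOnInterval (by rwa [uIcc_of_le hab])
  have huac : AbsolutelyContinuousOnInterval u a b :=
    LipschitzOnWith.absolutelyContinuousOnInterval (by rwa [uIcc_of_le hab])
  have hψint := (intervalIntegrable_iff_integrableOn_Ioo_of_le hab).1 hψac.intervalIntegrable_deriv
  have huint := (intervalIntegrable_iff_integrableOn_Ioo_of_le hab).1 huac.intervalIntegrable_deriv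
  have hnn : 0 ≤ ∫ x in Ioo a b, deriv ψ x := by
    rw [← integral_Ioc_eq_integral_Ioo, ← intervalIntegral.integral_of_le hab,
      hψac.integral_deriv_eq_sub]
    have ha : ψ a = 0 := by
      have := hτ a ⟨le_rfl, hab⟩
      simp only [Icc_self, mem_singleton_iff] at this
      simp [hψdef, this]
    rw [ha]
    simpa using hψ0 b ⟨hab, le_rfl⟩
  have hle : ∫ x in Ioo a b, deriv ψ x ≤
      ∫ x in Ioo a b, E.indicator (fun x => |deriv u x| - l) x := by
    refine setIntegral_mono_on_ae hψint ?_ measurableSet_Ioo ?_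
    · refine Integrable.indicator ?_ hEo.measurableSet
      exact huint.abs.sub (integrable_const _)
    · filter_upwards [hψac.boundedVariationOn.ae_differentiableAt_of_mem_uIcc,
        huac.boundedVariationOn.ae_differentiableAt_of_mem_uIcc] with x h1 h2 hx
      have hxI : x ∈ Icc a b := Ioo_subset_Icc_self hx
      have hxu : x ∈ uIcc a b := by rwa [uIcc_of_le hab]
      by_cases hpos : 0 < ψ x
      · rw [indicator_of_mem (show x ∈ E from ⟨hx, hpos⟩)]
        refine deriv_le_abs_deriv_sub (h1 hxu) (h2 hxu) ?_
        have hδ : ∀ᶠ z in 𝓝[>] x, (K + l) * (z - x) < ψ x := by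
          have : Tendsto (fun z => (K + l) * (z - x)) (𝓝 x) (𝓝 ((K + l) * (x - x))) := by
            apply Continuous.tendsto; fun_prop
          rw [sub_self, mul_zero] at this
          exact nhdsWithin_le_nhds (this.eventually_lt_const hpos)
        filter_upwards [hδ, Ioo_mem_nhdsGT hx.2] with z hz hzI
        have hz' : z ∈ Icc a b := ⟨hxI.1.trans hzI.1.le, hzI.2.le⟩
        rcases hup x hxI z hz' hzI.1.le with h | h
        · exact h
        · have := abs_nonneg (u z - u x)
          linarith
      · rw [indicator_of_notMem (fun h => hpos h.2)]
        have hx0 : ψ x = 0 := le_antisymm (not_lt.1 hpos) (hψ0 x hxI)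
        have : IsLocalMin ψ x := by
          filter_upwards [Icc_mem_nhds hx.1 hx.2] with z hz
          rw [hx0]; exact hψ0 z hz
        rw [this.deriv_eq_zero]
  rw [setIntegral_indicator hEo.measurableSet, inter_eq_self_of_subset_right inter_subset_left]
    at hle
  have : ∫ x in E, (l - |deriv u x|) = - ∫ x in E, (|deriv u x| - l) := by
    rw [← integral_neg]; simp
  linarith

/-! ### Level sets and the selection of a good part of a rectangle -/

/-- The partial derivative `∂ₓ f` of a function on `ℝ × ℝ`. -/
def px (f : ℝ × ℝ → ℝ) (p : ℝ × ℝ) : ℝ := fderiv ℝ f p (1, 0)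

/-- The partial derivative `∂_y f` of a function on `ℝ × ℝ`. -/
def py (f : ℝ × ℝ → ℝ) (p : ℝ × ℝ) : ℝ := fderiv ℝ f p (0, 1)

theorem continuous_px {f : ℝ × ℝ → ℝ} (hf : ContDiff ℝ 1 f) : Continuous (px f) :=
  (hf.continuous_fderiv one_ne_zero).clm_apply continuous_const

theorem continuous_py {f : ℝ × ℝ → ℝ} (hf : ContDiff ℝ 1 f) : Continuous (py f) :=
  (hf.continuous_fderiv one_ne_zero).clm_apply continuous_const

theorem fderiv_apply_eq_px_py (f : ℝ × ℝ → ℝ) (p v : ℝ × ℝ) :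
    fderiv ℝ f p v = v.1 * px f p + v.2 * py f p := by
  have : v = v.1 • ((1 : ℝ), (0 : ℝ)) + v.2 • ((0 : ℝ), (1 : ℝ)) := by ext <;> simp
  conv_lhs => rw [this]
  rw [map_add, map_smul, map_smul]
  rfl

theorem hasDerivAt_slice_fst {f : ℝ × ℝ → ℝ} (hf : ContDiff ℝ 1 f) (x y : ℝ) :
    HasDerivAt (fun t => f (t, y)) (px f (x, y)) x := by
  have h1 : HasFDerivAt f (fderiv ℝ f (x, y)) (x, y) :=
    (hf.differentiable one_ne_zero _).hasFDerivAt
  exact h1.comp_hasDerivAt x ((hasDerivAt_id x).prodMk (hasDerivAt_const x y))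

theorem hasDerivAt_slice_snd {f : ℝ × ℝ → ℝ} (hf : ContDiff ℝ 1 f) (x y : ℝ) :
    HasDerivAt (fun t => f (x, t)) (py f (x, y)) y := by
  have h1 : HasFDerivAt f (fderiv ℝ f (x, y)) (x, y) :=
    (hf.differentiable one_ne_zero _).hasFDerivAt
  exact h1.comp_hasDerivAt y ((hasDerivAt_const y x).prodMk (hasDerivAt_id y))

theorem det_prod_clm (L M : ℝ × ℝ →L[ℝ] ℝ) :
    (L.prod M).det = L (1, 0) * M (0, 1) - L (0, 1) * M (1, 0) := by
  rw [ContinuousLinearMap.det, ← LinearMap.det_toMatrix (Module.Basis.finTwoProd ℝ),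
    Matrix.det_fin_two]
  simp [LinearMap.toMatrix_apply]

theorem abs_clamp_sub_clamp_le (b b' s t : ℝ) :
    |max b (min b' s) - max b (min b' t)| ≤ |s - t| := by
  refine (abs_max_sub_max_le_max _ _ _ _).trans ?_
  rw [sub_self, abs_zero, max_eq_right (abs_nonneg _)]
  refine (abs_min_sub_min_le_max _ _ _ _).trans ?_
  rw [sub_self, abs_zero, max_eq_right (abs_nonneg _)]

section LevelCoordinates

variable {f : ℝ × ℝ → ℝ} {ε : ℝ}

theorem slice_snd_bijective (hf : ContDiff ℝ 1 f) (hε : 0 < ε) (hfy : ∀ p, ε ≤ py f p) (x : ℝ) :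
    Function.Bijective fun y => f (x, y) := by
  have hmono : Monotone fun y => f (x, y) - ε * y := by
    have hd : ∀ y, HasDerivAt (fun y => f (x, y) - ε * y) (py f (x, y) - ε * 1) y := fun y =>
      (hasDerivAt_slice_snd hf x y).sub ((hasDerivAt_id y).const_mul ε)
    refine monotone_of_deriv_nonneg (fun y => (hd y).differentiableAt) fun y => ?_
    rw [(hd y).deriv]
    linarith [hfy (x, y)]
  constructor
  · refine StrictMono.injective fun y z hyz => ?_
    have h1 := hmono hyz.le
    have h2 := mul_lt_mul_of_pos_left hyz hε
    simp only at h1 ⊢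
    linarith
  · refine Continuous.surjective (by have := hf.continuous; fun_prop) ?_ ?_
    · refine tendsto_atTop_mono' _ (f₁ := fun y => (f (x, 0) - ε * 0) + ε * y) ?_
        (tendsto_atTop_add_const_left _ _ (tendsto_id.const_mul_atTop hε))
      filter_upwards [eventually_ge_atTop 0] with y hy
      have h1 := hmono hy
      simp only at h1
      linarith
    · refine tendsto_atBot_mono' _ (f₁ := fun y => (f (x, 0) - ε * 0) + ε * y) ?_
        (tendsto_atBot_add_const_left _ _ (tendsto_id.const_mul_atBot hε))
      filter_upwards [eventually_le_atBot 0] with y hy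
      have h1 := hmono hy
      simp only at h1
      linarith

/-- When `∂_y f` is bounded below by a positive constant, `(x, y) ↦ (x, f (x, y))` is a global
`C¹` change of coordinates: the level sets of `f` are the graphs of the functions
`x ↦ Y (x, s)`. -/
theorem exists_level_coordinates (hf : ContDiff ℝ 1 f) (hε : 0 < ε) (hfy : ∀ p, ε ≤ py f p) :
    ∃ Y : ℝ × ℝ → ℝ, ContDiff ℝ 1 Y ∧ (∀ x s, f (x, Y (x, s)) = s) ∧
      ∀ x y, Y (x, f (x, y)) = y := by
  set Φ : ℝ × ℝ → ℝ × ℝ := fun p => (p.1, f p) with hΦ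
  have hΦc : ContDiff ℝ 1 Φ := contDiff_fst.prodMk hf
  have hdet : ∀ p, ((ContinuousLinearMap.fst ℝ ℝ ℝ).prod (fderiv ℝ f p)).det ≠ 0 := by
    intro p
    have : (fderiv ℝ f p) (0, 1) = py f p := rfl
    rw [det_prod_clm]
    simp only [ContinuousLinearMap.coe_fst', one_mul, zero_mul, sub_zero, this]
    exact (hε.trans_le (hfy p)).ne'
  set A : ℝ × ℝ → (ℝ × ℝ) ≃L[ℝ] (ℝ × ℝ) := fun p =>
    ContinuousLinearMap.toContinuousLinearEquivOfDetNeZero _ (hdet p) with hA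
  have hΦd : ∀ p, HasFDerivAt Φ (A p : ℝ × ℝ →L[ℝ] ℝ × ℝ) p := by
    intro p
    rw [hA, ContinuousLinearMap.coe_toContinuousLinearEquivOfDetNeZero]
    exact hasFDerivAt_fst.prodMk (hf.differentiable one_ne_zero p).hasFDerivAt
  have hΦs : ∀ p, HasStrictFDerivAt Φ (A p : ℝ × ℝ →L[ℝ] ℝ × ℝ) p := fun p =>
    hΦc.contDiffAt.hasStrictFDerivAt' (hΦd p) one_ne_zero
  have hbij : Function.Bijective Φ := by
    constructor
    · rintro ⟨x, y⟩ ⟨x', y'⟩ h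
      simp only [hΦ, Prod.mk.injEq] at h
      obtain ⟨rfl, h⟩ := h
      rw [(slice_snd_bijective hf hε hfy x).1 h]
    · rintro ⟨x, s⟩
      obtain ⟨y, hy⟩ := (slice_snd_bijective hf hε hfy x).2 s
      exact ⟨(x, y), by simpa [hΦ] using hy⟩
  have hopen : IsOpenMap Φ := isOpenMap_of_hasStrictFDerivAt_equiv hΦs
  set e := (Equiv.ofBijective Φ hbij).toHomeomorphOfContinuousOpen hΦc.continuous hopen with he
  have heΦ : ∀ p, e p = Φ p := fun p => rfl
  have hsymm : ContDiff ℝ 1 e.symm := e.contDiff_symm hΦd hΦc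
  refine ⟨fun w => (e.symm w).2, contDiff_snd.comp hsymm, fun x s => ?_, fun x y => ?_⟩
  · have h : Φ (e.symm (x, s)) = (x, s) := by rw [← heΦ, e.apply_symm_apply]
    simp only [hΦ, Prod.mk.injEq] at h
    have h' : (x, (e.symm (x, s)).2) = e.symm (x, s) := by ext <;> simp [h.1]
    rw [h', h.2]
  · have : (x, f (x, y)) = e (x, y) := rfl
    simp [this]

/-- Selection of a good part of a rectangle: let `f` be strictly increasing in `y`. Outside a set on
which the integral of `l ∂_y f - |∂ₓ f|` is nonpositive, two points on the same level set of `f`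
always see each other under slope at most `l`. The set is found level by level, by the rising sun
lemma applied to the graph `y = Y (x, s)` cut off at the bottom and the top of the rectangle. -/
theorem exists_selection (hf : ContDiff ℝ 1 f) (hε : 0 < ε) (hfy : ∀ p, ε ≤ py f p) {l : ℝ}
    (hl : 0 ≤ l) {a a' b b' : ℝ} (ha : a ≤ a') (hb : b ≤ b') :
    ∃ G, MeasurableSet G ∧ G ⊆ Ioo a a' ×ˢ Ioo b b' ∧
      (∀ p ∈ G, ∀ q ∈ G, f p = f q → |p.2 - q.2| ≤ l * |p.1 - q.1|) ∧
      ∫ p in (Ioo a a' ×ˢ Ioo b b') \ G, (l * py f p - |px f p|) ≤ 0 := by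
  obtain ⟨Y, hY, hfY, hYf⟩ := exists_level_coordinates hf hε hfy
  set c : ℝ → ℝ := fun t => max b (min b' t) with hc
  have hcc : Continuous c := by fun_prop
  have hcid : ∀ t ∈ Ioo b b', c t = t := fun t ht => by
    simp only [hc]; rw [min_eq_right ht.2.le, max_eq_right ht.1.le]
  set W : Set (ℝ × ℝ) := ⋃ t ∈ Ici a,
    {w | t < w.1 ∧ l * (w.1 - t) < |c (Y w) - c (Y (t, w.2))|} with hW
  have hYc := hY.continuous
  have hWo : IsOpen W := by
    refine isOpen_biUnion fun t _ => ?_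
    have h1 : IsOpen {w : ℝ × ℝ | t < w.1} := isOpen_lt continuous_const continuous_fst
    have h2 : IsOpen {w : ℝ × ℝ | l * (w.1 - t) < |c (Y w) - c (Y (t, w.2))|} :=
      isOpen_lt (by fun_prop) (by fun_prop)
    exact h1.inter h2
  have hWmem : ∀ x s, (x, s) ∈ W ↔ ∃ t ∈ Icc a x, l * (x - t) < |c (Y (x, s)) - c (Y (t, s))| := by
    intro x s
    simp only [hW, mem_iUnion, mem_ofPred_eq, mem_Ici, exists_prop, mem_Icc]
    constructor
    · rintro ⟨t, h1, h2, h3⟩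
      exact ⟨t, ⟨h1, h2.le⟩, h3⟩
    · rintro ⟨t, ⟨h1, h2⟩, h3⟩
      refine ⟨t, h1, lt_of_le_of_ne h2 ?_, h3⟩
      rintro rfl
      simp at h3
  set Φ : ℝ × ℝ → ℝ × ℝ := fun p => (p.1, f p) with hΦ
  have hfc := hf.continuous
  have hΦc : Continuous Φ := by fun_prop
  set R : Set (ℝ × ℝ) := Ioo a a' ×ˢ Ioo b b' with hR
  have hRm : MeasurableSet R := measurableSet_Ioo.prod measurableSet_Ioo
  have hWm : MeasurableSet (Φ ⁻¹' W) := hΦc.measurable hWo.measurableSet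
  refine ⟨R \ Φ ⁻¹' W, hRm.diff hWm, sdiff_subset, ?_, ?_⟩
  · have key : ∀ p ∈ R \ Φ ⁻¹' W, ∀ q ∈ R \ Φ ⁻¹' W, f p = f q → q.1 ≤ p.1 →
        |p.2 - q.2| ≤ l * |p.1 - q.1| := by
      rintro ⟨x, y⟩ hp ⟨x', y'⟩ hq hpq hle
      have h1 : ¬ (x, f (x, y)) ∈ W := hp.2
      rw [hWmem] at h1
      push Not at h1
      have h2 := h1 x' ⟨hq.1.1.1.le, hle⟩
      rw [hYf, hpq, hYf, hcid y hp.1.2, hcid y' hq.1.2] at h2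
      rwa [abs_of_nonneg (sub_nonneg.2 hle)]
    intro p hp q hq hpq
    rcases le_total q.1 p.1 with h | h
    · exact key p hp q hq hpq h
    · rw [abs_sub_comm, abs_sub_comm p.1]
      exact key q hq p hp hpq.symm h
  · rw [Set.sdiff_sdiff_right_self]
    set D := R ∩ Φ ⁻¹' W with hD
    have hDm : MeasurableSet D := hRm.inter hWm
    set g : ℝ × ℝ → ℝ := fun w => l - |deriv (fun x => Y (x, w.2)) w.1| with hg
    have hYx : ∀ x s, HasDerivAt (fun t => Y (t, s)) (px Y (x, s)) x := hasDerivAt_slice_fst hY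
    have hgΦ : ∀ p, |((ContinuousLinearMap.fst ℝ ℝ ℝ).prod (fderiv ℝ f p)).det| • g (Φ p)
        = l * py f p - |px f p| := by
      rintro ⟨x, y⟩
      have hpos : 0 < py f (x, y) := hε.trans_le (hfy _)
      have h1 : px f (x, y) + px Y (x, f (x, y)) * py f (x, y) = 0 := by
        have h2 : HasFDerivAt f (fderiv ℝ f (x, Y (x, f (x, y)))) (x, Y (x, f (x, y))) :=
          (hf.differentiable one_ne_zero _).hasFDerivAt
        have h3 := h2.comp_hasDerivAt x ((hasDerivAt_id x).prodMk (hYx x (f (x, y))))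
        have h4 : HasDerivAt (fun t => f (t, Y (t, f (x, y)))) 0 x := by
          simp only [hfY]; exact hasDerivAt_const _ _
        have h5 := h3.unique h4
        rw [hYf, fderiv_apply_eq_px_py] at h5
        simpa using h5
      rw [det_prod_clm]
      have h6 : (fderiv ℝ f (x, y)) (0, 1) = py f (x, y) := rfl
      simp only [ContinuousLinearMap.coe_fst', one_mul, zero_mul, sub_zero, h6, hg, hΦ,
        (hYx x _).deriv, smul_eq_mul]
      rw [abs_of_pos hpos, show px f (x, y) = -(px Y (x, f (x, y)) * py f (x, y)) by linarith,
        abs_neg, abs_mul, abs_of_pos hpos]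
      ring
    have hΦd : ∀ p ∈ D, HasFDerivWithinAt Φ ((ContinuousLinearMap.fst ℝ ℝ ℝ).prod (fderiv ℝ f p))
        D p := fun p _ =>
      (hasFDerivAt_fst.prodMk (hf.differentiable one_ne_zero p).hasFDerivAt).hasFDerivWithinAt
    have hΦi : InjOn Φ D := by
      rintro ⟨x, y⟩ _ ⟨x', y'⟩ _ h
      simp only [hΦ, Prod.mk.injEq] at h
      obtain ⟨rfl, h⟩ := h
      rw [← hYf x y, h, hYf]
    have hpc : Continuous fun p => l * py f p - |px f p| := by
      have := continuous_px hf
      have := continuous_py hf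
      fun_prop
    have hint : IntegrableOn (fun p => l * py f p - |px f p|) D := by
      refine IntegrableOn.mono_set ((hpc.continuousOn).integrableOn_compact
        (isCompact_Icc.prod isCompact_Icc)) (t := Icc a a' ×ˢ Icc b b') ?_
      exact inter_subset_left.trans (prod_mono Ioo_subset_Icc_self Ioo_subset_Icc_self)
    have hcov := integral_image_eq_integral_abs_det_fderiv_smul volume hDm hΦd hΦi g
    simp only [hgΦ] at hcov
    have hgint : IntegrableOn g (Φ '' D) := by
      rw [integrableOn_image_iff_integrableOn_abs_det_fderiv_smul volume hDm hΦd hΦi]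
      simpa only [hgΦ] using hint
    rw [← hcov]
    have himage : Φ '' D = {w | w.1 ∈ Ioo a a' ∧ Y w ∈ Ioo b b' ∧ w ∈ W} := by
      ext ⟨x, s⟩
      constructor
      · rintro ⟨⟨x', y⟩, ⟨⟨h1, h2⟩, h3⟩, h4⟩
        simp only [hΦ, Prod.mk.injEq] at h4
        obtain ⟨rfl, rfl⟩ := h4
        exact ⟨h1, by rwa [hYf], h3⟩
      · rintro ⟨h1, h2, h3⟩
        refine ⟨(x, Y (x, s)), ⟨⟨h1, h2⟩, ?_⟩, ?_⟩
        · change (x, f (x, Y (x, s))) ∈ W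
          rwa [hfY]
        · simp [hΦ, hfY]
    have hDm' : MeasurableSet (Φ '' D) := by
      rw [himage]
      exact (measurable_fst measurableSet_Ioo).inter
        ((hYc.measurable measurableSet_Ioo).inter hWo.measurableSet)
    rw [← integral_indicator hDm', Measure.volume_eq_prod, integral_prod_symm]
    swap
    · rw [← Measure.volume_eq_prod]; exact hgint.integrable_indicator hDm'
    refine integral_nonpos fun s => ?_
    set u : ℝ → ℝ := fun x => c (Y (x, s)) with hu
    have hYs : ContDiff ℝ 1 fun x => Y (x, s) := hY.comp (contDiff_id.prodMk contDiff_const)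
    obtain ⟨K, hK⟩ := hYs.contDiffOn.exists_lipschitzOnWith one_ne_zero (convex_Icc a a')
      isCompact_Icc
    have hKu : LipschitzOnWith K u (Icc a a') := by
      refine LipschitzOnWith.of_dist_le_mul fun x hx y hy => le_trans ?_ (hK.dist_le_mul x hx y hy)
      rw [Real.dist_eq, Real.dist_eq]
      exact abs_clamp_sub_clamp_le _ _ _ _
    set E : Set ℝ := {x ∈ Ioo a a' | ∃ t ∈ Icc a x, l * (x - t) < |u x - u t|} with hE
    have hEW : E = {x | x ∈ Ioo a a' ∧ (x, s) ∈ W} := by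
      ext x; simp only [hE, mem_ofPred_eq, hWmem]; rfl
    have hEm : MeasurableSet E := by
      rw [hEW]
      exact measurableSet_Ioo.inter
        ((hWo.preimage (f := fun x : ℝ => (x, s)) (by fun_prop)).measurableSet)
    have hrs := setIntegral_sub_abs_deriv_nonpos ha hl hKu
    set V : Set ℝ := {x | Y (x, s) ∈ Ioo b b'} with hV
    have hVo : IsOpen V := isOpen_Ioo.preimage (f := fun x => Y (x, s)) (by fun_prop)
    have hslice : (fun x => (Φ '' D).indicator g (x, s))
        = (E ∩ V).indicator fun x => l - |deriv u x| := by
      funext x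
      by_cases hx : x ∈ E ∩ V
      · have hx' : (x, s) ∈ Φ '' D := by
          rw [himage]; rw [hEW] at hx; exact ⟨hx.1.1, hx.2, hx.1.2⟩
        rw [indicator_of_mem hx, indicator_of_mem hx']
        have hloc : u =ᶠ[𝓝 x] fun t => Y (t, s) := by
          filter_upwards [hVo.mem_nhds hx.2] with t ht
          exact hcid _ ht
        simp only [hg, hloc.deriv_eq]
      · have hx' : (x, s) ∉ Φ '' D := by
          rw [himage]; rw [hEW] at hx
          exact fun h => hx ⟨⟨h.1, h.2.2⟩, h.2.1⟩
        rw [indicator_of_notMem hx, indicator_of_notMem hx']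
    change ∫ x, (Φ '' D).indicator g (x, s) ≤ 0
    rw [hslice, integral_indicator (hEm.inter hVo.measurableSet)]
    have huac : AbsolutelyContinuousOnInterval u a a' :=
      LipschitzOnWith.absolutelyContinuousOnInterval (by rwa [uIcc_of_le ha])
    have huint := (intervalIntegrable_iff_integrableOn_Ioo_of_le ha).1 huac.intervalIntegrable_deriv
    have hint' : IntegrableOn (fun x => l - |deriv u x|) E := by
      refine IntegrableOn.mono_set (t := Ioo a a') ?_ fun x hx => hx.1
      exact (integrable_const l).sub huint.abs
    rw [← integral_inter_add_sdiff hVo.measurableSet hint'] at hrs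
    have hrest : 0 ≤ ∫ x in E \ V, (l - |deriv u x|) := by
      refine setIntegral_nonneg (hEm.diff hVo.measurableSet) fun x hx => ?_
      -- off `V` the cut-off level function attains its minimum or maximum, so its derivative is `0`
      have hd : deriv u x = 0 := by
        have hxV : ¬ (b < Y (x, s) ∧ Y (x, s) < b') := hx.2
        rcases not_and_or.1 hxV with h | h
        · have hxb : u x = b := by
            simp only [hu, hc]; exact max_eq_left ((min_le_right _ _).trans (not_lt.1 h))
          refine IsLocalMin.deriv_eq_zero (Eventually.of_forall fun t => ?_)
          rw [hxb]; exact le_max_left _ _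
        · have hxb : u x = b' := by
            simp only [hu, hc]; rw [min_eq_left (not_lt.1 h), max_eq_right hb]
          refine IsLocalMax.deriv_eq_zero (Eventually.of_forall fun t => ?_)
          rw [hxb]; exact max_le hb (min_le_left _ _)
      rw [hd, abs_zero, sub_zero]
      exact hl
    linarith

end LevelCoordinates

/-! ### Stream functions on a unit square -/

theorem contDiff_of_partials {f f₁ f₂ : ℝ × ℝ → ℝ} (h₁ : Continuous f₁) (h₂ : Continuous f₂)
    (hf₁ : ∀ x y, HasDerivAt (fun t => f (t, y)) (f₁ (x, y)) x)
    (hf₂ : ∀ x y, HasDerivAt (fun t => f (x, t)) (f₂ (x, y)) y) :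
    ContDiff ℝ 1 f ∧ px f = f₁ ∧ py f = f₂ := by
  set L : (ℝ × ℝ → ℝ) → ℝ × ℝ → ℝ →L[ℝ] ℝ := fun g p => ContinuousLinearMap.toSpanSingleton ℝ (g p)
    with hL
  have hLc : ∀ g, Continuous g → Continuous (L g) := fun g hg =>
    (ContinuousLinearMap.toSpanSingletonCLE (𝕜 := ℝ) (E := ℝ)).continuous.comp hg
  have hd : ∀ p, HasFDerivAt f ((L f₁ p).coprod (L f₂ p)) p := by
    intro p
    have := hasStrictFDerivAt_uncurry_coprod (𝕜 := ℝ) (u := p) (f := fun x y => f (x, y))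
      (f₁ := fun x y => L f₁ (x, y)) (f₂ := fun x y => L f₂ (x, y))
      (Eventually.of_forall fun v => (hf₁ v.1 v.2).hasFDerivAt)
      (Eventually.of_forall fun v => (hf₂ v.1 v.2).hasFDerivAt)
      (hLc _ h₁).continuousAt (hLc _ h₂).continuousAt
    exact this.hasFDerivAt
  refine ⟨?_, ?_, ?_⟩
  · rw [contDiff_one_iff_hasFDerivAt]
    refine ⟨_, ?_, hd⟩
    have h1 := hLc _ h₁
    have h2 := hLc _ h₂
    exact (ContinuousLinearMap.coprodEquivL (𝕜 := ℝ) (E := ℝ) (F := ℝ) (G := ℝ) ℝ).continuous.comp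
      (h1.prodMk h2)
  · funext p
    rw [px, (hd p).fderiv]
    simp [hL]
  · funext p
    rw [py, (hd p).fderiv]
    simp [hL]

theorem hasDerivAt_parametric_intervalIntegral {H H' : ℝ × ℝ → ℝ} (hH : Continuous H)
    (hH' : Continuous H') (hd : ∀ x t, HasDerivAt (fun x => H (x, t)) (H' (x, t)) x) (c d x : ℝ) :
    HasDerivAt (fun x => ∫ t in c..d, H (x, t)) (∫ t in c..d, H' (x, t)) x := by
  obtain ⟨B, hB⟩ := ((isCompact_Icc (a := x - 1) (b := x + 1)).prod
    (isCompact_uIcc (a := c) (b := d))).exists_bound_of_continuousOn hH'.continuousOn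
  refine (intervalIntegral.hasDerivAt_integral_of_dominated_loc_of_deriv_le
    (F := fun x t => H (x, t)) (F' := fun x t => H' (x, t)) (bound := fun _ => B)
    (s := Icc (x - 1) (x + 1)) (Icc_mem_nhds (by linarith) (by linarith)) ?_ ?_ ?_ ?_ ?_ ?_).2
  · exact Eventually.of_forall fun z =>
      (hH.comp (Continuous.prodMk_right z)).aestronglyMeasurable
  · exact (hH.comp (Continuous.prodMk_right x)).intervalIntegrable _ _
  · exact (hH'.comp (Continuous.prodMk_right x)).aestronglyMeasurable
  · exact Eventually.of_forall fun t ht z hz => hB _ ⟨hz, uIoc_subset_uIcc ht⟩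
  · exact intervalIntegrable_const
  · exact Eventually.of_forall fun t _ z _ => hd z t

theorem setIntegral_Ioo_prod_Ioo {F : ℝ × ℝ → ℝ} (hF : Continuous F) {a a' b b' : ℝ} (ha : a ≤ a')
    (hb : b ≤ b') :
    ∫ p in Ioo a a' ×ˢ Ioo b b', F p = ∫ x in a..a', ∫ y in b..b', F (x, y) := by
  have hint : IntegrableOn F (Ioo a a' ×ˢ Ioo b b') :=
    (hF.continuousOn.integrableOn_compact (isCompact_Icc.prod isCompact_Icc)).mono_set
      (prod_mono Ioo_subset_Icc_self Ioo_subset_Icc_self)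
  rw [Measure.volume_eq_prod] at hint ⊢
  rw [setIntegral_prod _ hint, intervalIntegral.integral_of_le ha, integral_Ioc_eq_integral_Ioo]
  refine setIntegral_congr_fun measurableSet_Ioo fun x _ => ?_
  rw [intervalIntegral.integral_of_le hb, integral_Ioc_eq_integral_Ioo]

theorem integrableOn_Ioo_prod_Ioo {F : ℝ × ℝ → ℝ} (hF : Continuous F) (a a' b b' : ℝ) :
    IntegrableOn F (Ioo a a' ×ˢ Ioo b b') :=
  (hF.continuousOn.integrableOn_compact (isCompact_Icc.prod isCompact_Icc)).mono_set
    (prod_mono Ioo_subset_Icc_self Ioo_subset_Icc_self)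

theorem exists_le_intervalIntegral {k : ℝ → ℝ} (hk : Continuous k) (b : ℝ) :
    ∃ y ∈ Icc b (b + 1), k y ≤ ∫ t in b..b + 1, k t := by
  obtain ⟨y, hy, hmin⟩ := isCompact_Icc.exists_isMinOn (nonempty_Icc.2 (by linarith : b ≤ b + 1))
    hk.continuousOn
  refine ⟨y, hy, ?_⟩
  have := intervalIntegral.integral_mono_on (by linarith : b ≤ b + 1)
    (intervalIntegrable_const (μ := volume) (c := k y)) (hk.intervalIntegrable b (b + 1))
    fun t ht => hmin ht
  simpa using this

theorem intervalIntegral_mono_interval_of_nonneg {k : ℝ → ℝ} (hk : Continuous k)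
    (h0 : ∀ t, 0 ≤ k t) {a a' c d : ℝ} (hac : a ≤ c) (hcd : c ≤ d) (hda : d ≤ a') :
    ∫ t in c..d, k t ≤ ∫ t in a..a', k t :=
  intervalIntegral.integral_mono_interval hac hcd hda (Eventually.of_forall h0)
    (hk.intervalIntegrable _ _)

theorem abs_intervalIntegral_le_of_mem_Icc {k : ℝ → ℝ} (hk : Continuous k) {a a' c d : ℝ}
    (hc : c ∈ Icc a a') (hd : d ∈ Icc a a') :
    |∫ t in c..d, k t| ≤ ∫ t in a..a', |k t| := by
  have key : ∀ c ∈ Icc a a', ∀ d ∈ Icc a a', c ≤ d → |∫ t in c..d, k t| ≤ ∫ t in a..a', |k t| := by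
    intro c hc d hd hcd
    exact (intervalIntegral.abs_integral_le_integral_abs hcd).trans
      (intervalIntegral_mono_interval_of_nonneg hk.abs (fun _ => abs_nonneg _) hc.1 hcd hd.2)
  rcases le_total c d with h | h
  · exact key c hc d hd h
  · rw [intervalIntegral.integral_symm, abs_neg]
    exact key d hd c hc h

variable {P Q : ℝ × ℝ → ℝ}

/-- The flux of a field with nonnegative first component through a vertical segment of length `1` is
controlled by the field and its divergence near the segment. The flux is compared with the one
weighted by the parabola `(y - b + 1) (b + 2 - y) / 2`, which is at least `1` on the segment and
vanishes at both ends of the segment three times as long. -/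
theorem flux_le (hP : ContDiff ℝ 1 P) (hQ : ContDiff ℝ 1 Q) (hP0 : ∀ p, 0 ≤ P p) (a b : ℝ)
    {x : ℝ} (hx : x ∈ Icc a (a + 1)) :
    ∫ y in b..b + 1, P (x, y) ≤
      2 * ∫ p in Ioo a (a + 1) ×ˢ Ioo (b - 1) (b + 2), (|P p| + |Q p| + |px P p + py Q p|) := by
  have hPc := hP.continuous
  have hQc := hQ.continuous
  have hPx := continuous_px hP
  have hQy := continuous_py hQ
  set w : ℝ → ℝ := fun y => (y - b + 1) * (b + 2 - y) / 2 with hw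
  set w' : ℝ → ℝ := fun y => (2 * b + 1 - 2 * y) / 2 with hw'
  have hwd : ∀ y, HasDerivAt w (w' y) y := by
    intro y
    have h1 : HasDerivAt (fun y => (y - b + 1) * (b + 2 - y) / 2)
        ((1 * (b + 2 - y) + (y - b + 1) * (0 - 1)) / 2) y :=
      ((((hasDerivAt_id y).sub_const b).add_const 1).mul
        ((hasDerivAt_const y (b + 2)).sub (hasDerivAt_id y))).div_const 2
    convert h1 using 1
    simp only [hw']
    ring
  have hwc : Continuous w := by fun_prop
  have hwc' : Continuous w' := by fun_prop
  have hw0 : ∀ y ∈ Icc (b - 1) (b + 2), 0 ≤ w y ∧ w y ≤ 2 ∧ |w' y| ≤ 2 := by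
    intro y hy
    refine ⟨?_, ?_, ?_⟩
    · have := mul_nonneg (by linarith [hy.1] : 0 ≤ y - b + 1) (by linarith [hy.2] : 0 ≤ b + 2 - y)
      simp only [hw]; linarith
    · simp only [hw]; nlinarith [sq_nonneg (y - b - 1 / 2)]
    · simp only [hw']; rw [abs_le]; constructor <;> linarith [hy.1, hy.2]
  set h : ℝ → ℝ := fun x => ∫ y in b - 1..b + 2, w y * P (x, y) with hh
  set h' : ℝ → ℝ := fun x => ∫ y in b - 1..b + 2, w y * px P (x, y) with hh'
  have hhd : ∀ x, HasDerivAt h (h' x) x := fun x =>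
    hasDerivAt_parametric_intervalIntegral (H := fun p => w p.2 * P p)
      (H' := fun p => w p.2 * px P p) (by fun_prop) (by fun_prop)
      (fun x t => (hasDerivAt_slice_fst hP x t).const_mul (w t)) _ _ x
  have hhc : Continuous h := continuous_iff_continuousAt.2 fun x => (hhd x).continuousAt
  have hhc' : Continuous h' := by
    simp only [hh']
    fun_prop
  have hle1 : (b - 1) ≤ b + 2 := by linarith
  set k : ℝ → ℝ := fun x => ∫ y in b - 1..b + 2, (|P (x, y)| + |Q (x, y)|
    + |px P (x, y) + py Q (x, y)|) with hk
  have hkc : Continuous k := by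
    simp only [hk]
    fun_prop
  have hsum : ∀ x, h x + |h' x| ≤ 2 * k x := by
    intro x
    have hparts : ∫ y in b - 1..b + 2, w y * py Q (x, y)
        = w (b + 2) * Q (x, b + 2) - w (b - 1) * Q (x, b - 1)
          - ∫ y in b - 1..b + 2, w' y * Q (x, y) :=
      intervalIntegral.integral_mul_deriv_eq_deriv_mul (fun y _ => hwd y)
        (fun y _ => hasDerivAt_slice_snd hQ x y) (hwc'.intervalIntegrable _ _)
        (Continuous.intervalIntegrable (by fun_prop) _ _)
    have hwe : w (b + 2) = 0 ∧ w (b - 1) = 0 := by constructor <;> simp [hw]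
    rw [hwe.1, hwe.2, zero_mul, zero_mul, sub_zero, zero_sub] at hparts
    have hh'x : h' x = ∫ y in b - 1..b + 2,
        (w y * (px P (x, y) + py Q (x, y)) + w' y * Q (x, y)) := by
      have e1 : h' x + ∫ y in b - 1..b + 2, w y * py Q (x, y)
          = ∫ y in b - 1..b + 2, w y * (px P (x, y) + py Q (x, y)) := by
        rw [hh', ← intervalIntegral.integral_add (Continuous.intervalIntegrable (by fun_prop) _ _)
          (Continuous.intervalIntegrable (by fun_prop) _ _)]
        simp only [mul_add]
      rw [intervalIntegral.integral_add (Continuous.intervalIntegrable (by fun_prop) _ _)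
          (Continuous.intervalIntegrable (by fun_prop) _ _), ← e1, hparts]
      ring
    have h1 : |h' x| ≤ ∫ y in b - 1..b + 2,
        |w y * (px P (x, y) + py Q (x, y)) + w' y * Q (x, y)| := by
      rw [hh'x]; exact intervalIntegral.abs_integral_le_integral_abs hle1
    have h2 : h x + ∫ y in b - 1..b + 2,
        |w y * (px P (x, y) + py Q (x, y)) + w' y * Q (x, y)| ≤ 2 * k x := by
      rw [hk, hh, ← intervalIntegral.integral_const_mul,
        ← intervalIntegral.integral_add (Continuous.intervalIntegrable (by fun_prop) _ _)
          (Continuous.intervalIntegrable (by fun_prop) _ _)]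
      refine intervalIntegral.integral_mono_on hle1
        (Continuous.intervalIntegrable (by fun_prop) _ _)
        (Continuous.intervalIntegrable (by fun_prop) _ _) fun y hy => ?_
      obtain ⟨g1, g2, g3⟩ := hw0 y hy
      have e1 := abs_add_le (w y * (px P (x, y) + py Q (x, y))) (w' y * Q (x, y))
      rw [abs_mul, abs_mul, abs_of_nonneg g1] at e1
      have e2 := mul_le_mul_of_nonneg_right g2 (abs_nonneg (px P (x, y) + py Q (x, y)))
      have e3 := mul_le_mul_of_nonneg_right g3 (abs_nonneg (Q (x, y)))
      have e4 := mul_le_mul_of_nonneg_right g2 (hP0 (x, y))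
      rw [abs_of_nonneg (hP0 (x, y))]
      linarith
    linarith
  -- the weighted flux is at most average at some `x₁`, and its variation is bounded by the integral of `|h'|`
  obtain ⟨x₁, hx₁, hx₁'⟩ := exists_le_intervalIntegral hhc a
  have hftc : h x - h x₁ = ∫ t in x₁..x, h' t :=
    (intervalIntegral.integral_eq_sub_of_hasDerivAt (fun t _ => hhd t)
      (hhc'.intervalIntegrable _ _)).symm
  have hdiff := (le_abs_self _).trans (abs_intervalIntegral_le_of_mem_Icc hhc' hx₁ hx)
  have htot : (∫ t in a..a + 1, h t) + ∫ t in a..a + 1, |h' t| ≤ 2 * ∫ t in a..a + 1, k t := by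
    rw [← intervalIntegral.integral_add (hhc.intervalIntegrable _ _)
      (hhc'.abs.intervalIntegrable _ _), ← intervalIntegral.integral_const_mul]
    exact intervalIntegral.integral_mono_on (by linarith)
      ((hhc.add hhc'.abs).intervalIntegrable _ _)
      ((continuous_const.mul hkc).intervalIntegrable _ _) fun t _ => hsum t
  have hfl : ∫ y in b..b + 1, P (x, y) ≤ h x := by
    have e1 : ∫ y in b..b + 1, P (x, y) ≤ ∫ y in b..b + 1, w y * P (x, y) := by
      refine intervalIntegral.integral_mono_on (by linarith)
        (Continuous.intervalIntegrable (by fun_prop) _ _)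
        (Continuous.intervalIntegrable (by fun_prop) _ _) fun y hy => ?_
      have : 1 ≤ w y := by
        have := mul_nonneg (sub_nonneg.2 hy.1) (sub_nonneg.2 hy.2)
        simp only [hw]; nlinarith
      exact le_mul_of_one_le_left (hP0 _) this
    refine e1.trans ?_
    refine intervalIntegral.integral_mono_interval (by linarith) (by linarith) (by linarith) ?_
      (Continuous.intervalIntegrable (by fun_prop) _ _)
    filter_upwards [ae_restrict_mem measurableSet_Ioc] with y hy
    exact mul_nonneg (hw0 y ⟨hy.1.le, hy.2⟩).1 (hP0 _)
  rw [setIntegral_Ioo_prod_Ioo (by fun_prop) (by linarith) hle1]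
  simp only [hk] at htot
  linarith

/-- A stream function of a field on a unit square: up to the small parameter `ε`, its rotated
gradient is the field with a correction `α` of the second component that compensates the divergence.
The starting height of the integration is chosen so that the flux of the field through the
corresponding horizontal segment is at most average. -/
theorem exists_stream_function (hP : ContDiff ℝ 1 P) (hQ : ContDiff ℝ 1 Q) (hP0 : ∀ p, 0 ≤ P p)
    (a b : ℝ) : ∃ f : ℝ × ℝ → ℝ, ContDiff ℝ 1 f ∧ py f = P ∧
      (∀ p ∈ Ioo a (a + 1) ×ˢ Ioo b (b + 1), |f p| ≤
        3 * ∫ p in Ioo a (a + 1) ×ˢ Ioo (b - 1) (b + 2), (|P p| + |Q p| + |px P p + py Q p|)) ∧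
      ∫ p in Ioo a (a + 1) ×ˢ Ioo b (b + 1), |px f p + Q p| ≤
        ∫ p in Ioo a (a + 1) ×ˢ Ioo b (b + 1), |px P p + py Q p| := by
  have hPc := hP.continuous
  have hQc := hQ.continuous
  have hPx := continuous_px hP
  have hQy := continuous_py hQ
  have ha1 : a ≤ a + 1 := by linarith
  have hb1 : b ≤ b + 1 := by linarith
  obtain ⟨y₀, hy₀, hy₀'⟩ := exists_le_intervalIntegral
    (k := fun y => ∫ t in a..a + 1, |Q (t, y)|) (by fun_prop) b
  set f : ℝ × ℝ → ℝ := fun p => (∫ t in y₀..p.2, P (p.1, t)) - ∫ t in a..p.1, Q (t, y₀) with hf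
  set f₁ : ℝ × ℝ → ℝ := fun p => (∫ t in y₀..p.2, px P (p.1, t)) - Q (p.1, y₀) with hf₁
  have hf₁c : Continuous f₁ := by
    simp only [hf₁]
    refine Continuous.sub ?_ (by fun_prop)
    exact intervalIntegral.continuous_parametric_intervalIntegral_of_continuous
      (f := fun (p : ℝ × ℝ) t => px P (p.1, t)) (by fun_prop) continuous_snd
  obtain ⟨hfC, hfx, hfy⟩ := contDiff_of_partials (f := f) hf₁c hPc
    (fun x y => (hasDerivAt_parametric_intervalIntegral hPc hPx (hasDerivAt_slice_fst hP) _ _ x).sub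
      (Continuous.integral_hasStrictDerivAt (f := fun t => Q (t, y₀)) (by fun_prop) a x).hasDerivAt)
    (fun x y => (Continuous.integral_hasStrictDerivAt (f := fun t => P (x, t)) (by fun_prop)
      y₀ y).hasDerivAt.sub_const (∫ t in a..x, Q (t, y₀)))
  have hα : ∀ x y, px f (x, y) + Q (x, y) = ∫ t in y₀..y, (px P (x, t) + py Q (x, t)) := by
    intro x y
    have h1 : ∫ t in y₀..y, py Q (x, t) = Q (x, y) - Q (x, y₀) :=
      intervalIntegral.integral_eq_sub_of_hasDerivAt (fun t _ => hasDerivAt_slice_snd hQ x t)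
        (Continuous.intervalIntegrable (by fun_prop) _ _)
    rw [hfx, intervalIntegral.integral_add (Continuous.intervalIntegrable (by fun_prop) _ _)
      (Continuous.intervalIntegrable (by fun_prop) _ _), h1]
    simp only [hf₁]
    ring
  refine ⟨f, hfC, hfy, ?_, ?_⟩
  · rintro ⟨x, y⟩ ⟨hx, hy⟩
    have hx' : x ∈ Icc a (a + 1) := Ioo_subset_Icc_self hx
    have hy' : y ∈ Icc b (b + 1) := Ioo_subset_Icc_self hy
    have h1 := abs_intervalIntegral_le_of_mem_Icc (k := fun t => P (x, t)) (by fun_prop) hy₀ hy'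
    have h2 := abs_intervalIntegral_le_of_mem_Icc (k := fun t => Q (t, y₀)) (by fun_prop)
      ⟨le_rfl, ha1⟩ hx'
    simp only [abs_of_nonneg (hP0 _)] at h1
    have h3 := flux_le hP hQ hP0 a b hx'
    have h4 : ∫ y in b..b + 1, ∫ t in a..a + 1, |Q (t, y)| ≤
        ∫ p in Ioo a (a + 1) ×ˢ Ioo (b - 1) (b + 2), (|P p| + |Q p| + |px P p + py Q p|) := by
      have e1 : ∫ y in b..b + 1, ∫ t in a..a + 1, |Q (t, y)|
          = ∫ p in Ioo a (a + 1) ×ˢ Ioo b (b + 1), |Q p| := by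
        rw [setIntegral_Ioo_prod_Ioo (by fun_prop) ha1 hb1]
        refine intervalIntegral_intervalIntegral_swap ?_
        have hsw : Continuous (Function.uncurry fun y t => |Q (t, y)|) := by
          simp only [Function.uncurry_def]; fun_prop
        exact (hsw.continuousOn.integrableOn_compact (isCompact_uIcc.prod isCompact_uIcc)).mono_set
          (prod_mono uIoc_subset_uIcc uIoc_subset_uIcc)
      rw [e1]
      have e2 : ∫ p in Ioo a (a + 1) ×ˢ Ioo b (b + 1), |Q p| ≤
          ∫ p in Ioo a (a + 1) ×ˢ Ioo b (b + 1), (|P p| + |Q p| + |px P p + py Q p|) := by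
        refine setIntegral_mono (integrableOn_Ioo_prod_Ioo (by fun_prop) _ _ _ _)
          (integrableOn_Ioo_prod_Ioo (by fun_prop) _ _ _ _) fun p => ?_
        simp only
        linarith [abs_nonneg (P p), abs_nonneg (px P p + py Q p)]
      refine e2.trans (setIntegral_mono_set (integrableOn_Ioo_prod_Ioo (by fun_prop) _ _ _ _)
        (Eventually.of_forall fun p => ?_) (LE.le.eventuallyLE
          (prod_mono le_rfl (Ioo_subset_Ioo (by linarith) (by linarith)))))
      simp only [Pi.zero_apply]
      positivity
    have h5 : |f (x, y)| ≤ |∫ t in y₀..y, P (x, t)| + |∫ t in a..x, Q (t, y₀)| := abs_sub _ _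
    linarith
  · have hpf := continuous_px hfC
    rw [setIntegral_Ioo_prod_Ioo (by fun_prop) ha1 hb1,
      setIntegral_Ioo_prod_Ioo (by fun_prop) ha1 hb1]
    refine intervalIntegral.integral_mono_on ha1 (Continuous.intervalIntegrable (by fun_prop) _ _)
      (Continuous.intervalIntegrable (by fun_prop) _ _) fun x _ => ?_
    have : ∫ y in b..b + 1, |px f (x, y) + Q (x, y)|
        ≤ ∫ y in b..b + 1, ∫ t in b..b + 1, |px P (x, t) + py Q (x, t)| := by
      refine intervalIntegral.integral_mono_on hb1 (Continuous.intervalIntegrable (by fun_prop) _ _)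
        intervalIntegrable_const fun y hy => ?_
      rw [hα]
      exact abs_intervalIntegral_le_of_mem_Icc (by fun_prop) hy₀ hy
    simpa using this

/-! ### Two transversal fields on a unit square -/

theorem integral_mul_le_sqrt_mul_sqrt {α : Type*} [MeasurableSpace α] {μ : Measure α} {f g : α → ℝ}
    (hf0 : 0 ≤ᵐ[μ] f) (hg0 : 0 ≤ᵐ[μ] g) (hf : MemLp f 2 μ) (hg : MemLp g 2 μ) :
    ∫ x, f x * g x ∂μ ≤ √(∫ x, f x ^ 2 ∂μ) * √(∫ x, g x ^ 2 ∂μ) := by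
  have := integral_mul_le_Lp_mul_Lq_of_nonneg (μ := μ) (p := 2) (q := 2)
    Real.HolderConjugate.two_two hf0 hg0 (by simpa using hf) (by simpa using hg)
  simpa [Real.sqrt_eq_rpow] using this

theorem setIntegral_preimage_swap (F : ℝ × ℝ → ℝ) (s : Set (ℝ × ℝ)) :
    ∫ p in Prod.swap ⁻¹' s, F p.swap = ∫ p in s, F p := by
  have h : MeasurePreserving (Prod.swap : ℝ × ℝ → ℝ × ℝ) volume volume := by
    rw [Measure.volume_eq_prod]; exact Measure.measurePreserving_swap
  exact h.setIntegral_preimage_emb MeasurableEquiv.prodComm.measurableEmbedding F s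

variable {P Q P' Q' χ : ℝ × ℝ → ℝ}

/-- The selected part of a unit square for a single field, with `w = (1 - ε) ∂_y f - |∂ₓ f|` as the
substitute for `P - |Q|`. The function `f` is the stream function plus `ε (y - b)`, which makes it
strictly increasing in `y`. -/
theorem exists_selected_stream (hP : ContDiff ℝ 1 P) (hQ : ContDiff ℝ 1 Q) (hP0 : ∀ p, 0 ≤ P p)
    (a b : ℝ) {ε : ℝ} (hε : 0 < ε) (hε1 : ε < 1) :
    ∃ (f : ℝ × ℝ → ℝ) (G : Set (ℝ × ℝ)), ContDiff ℝ 1 f ∧ MeasurableSet G ∧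
      G ⊆ Ioo a (a + 1) ×ˢ Ioo b (b + 1) ∧ (∀ p, 0 < py f p) ∧
      (∀ p ∈ G, |f p| ≤
        3 * (∫ p in Ioo a (a + 1) ×ˢ Ioo (b - 1) (b + 2), (|P p| + |Q p| + |px P p + py Q p|))
          + ε) ∧
      (∀ p ∈ G, ∀ q ∈ G, f p = f q → |p.2 - q.2| ≤ (1 - ε) * |p.1 - q.1|) ∧
      (∀ p, (P p - |Q p|)⁺ ≤
        ((1 - ε) * py f p - |px f p|)⁺ + (|px f p + Q p| + ε * (P p + 1))) ∧
      ∫ p in (Ioo a (a + 1) ×ˢ Ioo b (b + 1)) \ G, (P p - |Q p|)⁺ ≤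
        (∫ p in Ioo a (a + 1) ×ˢ Ioo b (b + 1), (P p - |Q p|)⁻) +
        ((∫ p in Ioo a (a + 1) ×ˢ Ioo b (b + 1), |px f p + Q p|) +
        ε * ∫ p in Ioo a (a + 1) ×ˢ Ioo b (b + 1), (P p + 1)) ∧
      ∫ p in Ioo a (a + 1) ×ˢ Ioo b (b + 1), |px f p + Q p| ≤
        ∫ p in Ioo a (a + 1) ×ˢ Ioo b (b + 1), |px P p + py Q p| := by
  obtain ⟨f₀, hf₀, hfy₀, hM₀, hα₀⟩ := exists_stream_function hP hQ hP0 a b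
  have hPc := hP.continuous
  have hQc := hQ.continuous
  have hf₀c := continuous_px hf₀
  set f : ℝ × ℝ → ℝ := fun p => f₀ p + ε * (p.2 - b) with hf
  obtain ⟨hfC, hfx, hfy⟩ := contDiff_of_partials (f := f) (f₁ := px f₀) (f₂ := fun p => P p + ε)
    hf₀c (by fun_prop)
    (fun x y => (hasDerivAt_slice_fst hf₀ x y).add_const (ε * (y - b)))
    (fun x y => by
      have h1 := hasDerivAt_slice_snd hf₀ x y
      rw [hfy₀] at h1
      have h2 := (((hasDerivAt_id y).sub_const b).const_mul ε)
      rw [mul_one] at h2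
      exact h1.add h2)
  obtain ⟨G, hGm, hGR, hGi, hGint⟩ := exists_selection hfC hε
    (fun p => by rw [hfy]; linarith [hP0 p]) (l := 1 - ε) (by linarith)
    (by linarith : a ≤ a + 1) (by linarith : b ≤ b + 1)
  set R : Set (ℝ × ℝ) := Ioo a (a + 1) ×ˢ Ioo b (b + 1) with hR
  have hRm : MeasurableSet R := measurableSet_Ioo.prod measurableSet_Ioo
  have hcmp : ∀ p, |((1 - ε) * py f p - |px f p|) - (P p - |Q p|)| ≤
      |px f p + Q p| + ε * (P p + 1) := by
    intro p
    have h1 : |(|px f p| - |Q p|)| ≤ |px f p + Q p| := by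
      have := abs_abs_sub_abs_le (px f p) (-Q p)
      rwa [abs_neg, sub_neg_eq_add] at this
    rw [hfy]
    have h2 := hP0 p
    have h3 : 0 ≤ ε * P p := mul_nonneg hε.le h2
    rw [abs_le] at h1 ⊢
    constructor <;> nlinarith
  refine ⟨f, G, hfC, hGm, hGR, fun p => by rw [hfy]; linarith [hP0 p], ?_, hGi, ?_, ?_, ?_⟩
  · intro p hp
    have h1 := hM₀ p (hGR hp)
    have h2 : |ε * (p.2 - b)| ≤ ε := by
      have := (hGR hp).2
      rw [abs_of_nonneg (mul_nonneg hε.le (by linarith [this.1]))]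
      exact mul_le_of_le_one_right hε.le (by linarith [this.2])
    exact (abs_add_le _ _).trans (add_le_add h1 h2)
  · intro p
    have h1 := (abs_le.1 (hcmp p)).1
    rw [posPart_def (P p - |Q p|)]
    refine sup_le ?_ ?_
    · linarith [le_posPart ((1 - ε) * py f p - |px f p|)]
    · have := hP0 p
      positivity
  · have hpx : Continuous (px f) := continuous_px hfC
    have hpy : Continuous (py f) := continuous_py hfC
    have hi : ∀ F : ℝ × ℝ → ℝ, Continuous F → IntegrableOn F R := fun F hF =>
      integrableOn_Ioo_prod_Ioo hF _ _ _ _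
    have c1 : Continuous fun p => (P p - |Q p|)⁺ := by
      simp only [posPart_def]; fun_prop
    have c2 : Continuous fun p => (P p - |Q p|)⁻ := by
      simp only [negPart_def]; fun_prop
    have c3 : Continuous fun p => |px f p + Q p| := by fun_prop
    have c4 : Continuous fun p => P p + 1 := by fun_prop
    have c5 : Continuous fun p => (1 - ε) * py f p - |px f p| := by fun_prop
    have c6 : Continuous fun p => (P p - |Q p|)⁻ + (|px f p + Q p| + ε * (P p + 1)) := by fun_prop
    have hs : R \ G ⊆ R := sdiff_subset
    calc ∫ p in R \ G, (P p - |Q p|)⁺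
        ≤ ∫ p in R \ G, (((1 - ε) * py f p - |px f p|) +
            ((P p - |Q p|)⁻ + (|px f p + Q p| + ε * (P p + 1)))) := by
          refine setIntegral_mono ((hi _ c1).mono_set hs) ((hi _ (c5.add c6)).mono_set hs)
            fun p => ?_
          have h1 := (abs_le.1 (hcmp p)).1
          have h2 := posPart_sub_negPart (P p - |Q p|)
          simp only
          linarith
      _ = (∫ p in R \ G, ((1 - ε) * py f p - |px f p|)) +
            ∫ p in R \ G, ((P p - |Q p|)⁻ + (|px f p + Q p| + ε * (P p + 1))) :=
          integral_add ((hi _ c5).mono_set hs) ((hi _ c6).mono_set hs)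
      _ ≤ 0 + ∫ p in R, ((P p - |Q p|)⁻ + (|px f p + Q p| + ε * (P p + 1))) := by
          refine add_le_add hGint (setIntegral_mono_set (hi _ c6) (Eventually.of_forall fun p => ?_)
            (LE.le.eventuallyLE hs))
          have := hP0 p
          have := negPart_nonneg (P p - |Q p|)
          simp only [Pi.zero_apply]
          positivity
      _ = _ := by
          rw [zero_add, integral_add (hi _ c2) (hi _ (by fun_prop)),
            integral_add (hi _ c3) (hi _ (by fun_prop)), integral_const_mul]
  · rw [hfx]; exact hα₀

/-- If the gradients of `f` and `g` lie in transversal cones, the Jacobian of `(f, g)` dominates the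
squared distance to the boundaries of the cones. -/
theorem min_posPart_sq_le_abs_det {l fx fy gx gy : ℝ} (hl0 : 0 ≤ l) (hl : l ≤ 1) (hfy : 0 ≤ fy)
    (hgx : 0 ≤ gx) :
    min ((l * fy - |fx|)⁺) ((l * gx - |gy|)⁺) ^ 2 ≤ |fx * gy - fy * gx| := by
  rcases le_or_gt (l * fy - |fx|) 0 with h1 | h1
  · rw [posPart_of_nonpos h1, min_eq_left (posPart_nonneg _)]
    simp
  rcases le_or_gt (l * gx - |gy|) 0 with h2 | h2
  · rw [posPart_of_nonpos h2, min_eq_right (posPart_nonneg _)]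
    simp
  rw [posPart_of_nonneg h1.le, posPart_of_nonneg h2.le]
  set u := l * fy - |fx| with hu
  set v := l * gx - |gy| with hv
  have e1 : min u v ^ 2 ≤ u * v := by
    rw [sq]
    exact mul_le_mul (min_le_left _ _) (min_le_right _ _) (le_min h1.le h2.le) h1.le
  have e2 : |fx| * |gy| + u * v ≤ (l * fy) * (l * gx) := by
    have h3 : l * fy = u + |fx| := by linarith
    have h4 : l * gx = v + |gy| := by linarith
    rw [h3, h4]
    nlinarith [mul_nonneg h1.le (abs_nonneg gy), mul_nonneg h2.le (abs_nonneg fx)]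
  have e3 : (l * fy) * (l * gx) ≤ fy * gx :=
    mul_le_mul (mul_le_of_le_one_left hfy hl) (mul_le_of_le_one_left hgx hl)
      (mul_nonneg hl0 hgx) hfy
  have e4 : fy * gx - |fx| * |gy| ≤ |fx * gy - fy * gx| := by
    rw [← abs_mul, abs_sub_comm]
    have := le_abs_self (fx * gy)
    exact (sub_le_sub_left this _).trans (le_abs_self _)
  linarith

/-- The estimate on a unit square before the limit `ε → 0`, with the masses `M`, `M'` of the fields
on the rectangles which control the stream functions. The image of the selected set under the pair of
stream functions lies in a rectangle with sides `2 (3 M + ε)` and `2 (3 M' + ε)`. -/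
theorem square_estimate_aux (hP : ContDiff ℝ 1 P) (hQ : ContDiff ℝ 1 Q) (hP0 : ∀ p, 0 ≤ P p)
    (hP' : ContDiff ℝ 1 P') (hQ' : ContDiff ℝ 1 Q') (hP0' : ∀ p, 0 ≤ P' p)
    (hχ : Continuous χ) (hχ01 : ∀ p, χ p ∈ Icc (0 : ℝ) 1) (a b : ℝ) {ε M M' : ℝ} (hε : 0 < ε)
    (hε1 : ε < 1)
    (hM : M = ∫ p in Ioo a (a + 1) ×ˢ Ioo (b - 1) (b + 2), (|P p| + |Q p| + |px P p + py Q p|))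
    (hM' : M' = ∫ p in Ioo b (b + 1) ×ˢ Ioo (a - 1) (a + 2),
      (|P' p| + |Q' p| + |px P' p + py Q' p|)) :
    ∫ p in Ioo a (a + 1) ×ˢ Ioo b (b + 1),
        χ p * min ((P p - |Q p|)⁺) ((P' p.swap - |Q' p.swap|)⁺) ≤
      √(∫ p in Ioo a (a + 1) ×ˢ Ioo b (b + 1), χ p ^ 2) * √(4 * (3 * M + ε) * (3 * M' + ε)) +
      ((∫ p in Ioo a (a + 1) ×ˢ Ioo b (b + 1), (P p - |Q p|)⁻) +
      (∫ p in Ioo b (b + 1) ×ˢ Ioo a (a + 1), (P' p - |Q' p|)⁻) +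
      2 * ((∫ p in Ioo a (a + 1) ×ˢ Ioo b (b + 1), |px P p + py Q p|) +
        ε * ∫ p in Ioo a (a + 1) ×ˢ Ioo b (b + 1), (P p + 1)) +
      2 * ((∫ p in Ioo b (b + 1) ×ˢ Ioo a (a + 1), |px P' p + py Q' p|) +
        ε * ∫ p in Ioo b (b + 1) ×ˢ Ioo a (a + 1), (P' p + 1))) := by
  obtain ⟨f, G, hf, hGm, hGR, hfy, hfM, hGi, hfw, hfG, hfα⟩ :=
    exists_selected_stream hP hQ hP0 a b hε hε1
  obtain ⟨g, H, hg, hHm, hHR, hgy, hgM, hHi, hgw, hgH, hgα⟩ :=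
    exists_selected_stream hP' hQ' hP0' b a hε hε1
  rw [← hM] at hfM
  rw [← hM'] at hgM
  set R : Set (ℝ × ℝ) := Ioo a (a + 1) ×ˢ Ioo b (b + 1) with hR
  set R' : Set (ℝ × ℝ) := Ioo b (b + 1) ×ˢ Ioo a (a + 1) with hR'
  have hRm : MeasurableSet R := measurableSet_Ioo.prod measurableSet_Ioo
  have hRR' : Prod.swap ⁻¹' R' = R := by
    rw [hR, hR', preimage_swap_prod]
  have hPc := hP.continuous
  have hQc := hQ.continuous
  have hPc' := hP'.continuous
  have hQc' := hQ'.continuous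
  have hfx' := continuous_px hf
  have hfy' := continuous_py hf
  have hgx' := continuous_px hg
  have hgy' := continuous_py hg
  set H' : Set (ℝ × ℝ) := Prod.swap ⁻¹' H with hH'
  have hHm' : MeasurableSet H' := measurable_swap hHm
  set w : ℝ × ℝ → ℝ := fun p => (1 - ε) * py f p - |px f p| with hw
  set w' : ℝ × ℝ → ℝ := fun p => (1 - ε) * py g p - |px g p| with hw'
  set A : ℝ × ℝ → ℝ := fun p => |px f p + Q p| + ε * (P p + 1) with hA
  set A' : ℝ × ℝ → ℝ := fun p => |px g p + Q' p| + ε * (P' p + 1) with hA'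
  have hA0 : ∀ p, 0 ≤ A p := fun p => by have := hP0 p; simp only [hA]; positivity
  have hA0' : ∀ p, 0 ≤ A' p := fun p => by have := hP0' p; simp only [hA']; positivity
  set m : ℝ × ℝ → ℝ := fun p => min ((P p - |Q p|)⁺) ((P' p.swap - |Q' p.swap|)⁺) with hm
  set n : ℝ × ℝ → ℝ := fun p => min ((w p)⁺) ((w' p.swap)⁺) with hn
  have hm0 : ∀ p, 0 ≤ m p := fun p => le_min (posPart_nonneg _) (posPart_nonneg _)
  have hn0 : ∀ p, 0 ≤ n p := fun p => le_min (posPart_nonneg _) (posPart_nonneg _)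
  have hwc : Continuous w := by fun_prop
  have hwc' : Continuous w' := by fun_prop
  have hAc : Continuous A := by fun_prop
  have hAc' : Continuous A' := by fun_prop
  have hmc : Continuous m := by simp only [hm, posPart_def]; fun_prop
  have hnc : Continuous n := by simp only [hn, posPart_def]; fun_prop
  have hSP : Continuous fun p => (P p - |Q p|)⁺ := by simp only [posPart_def]; fun_prop
  have hTP : Continuous fun p => (P' p - |Q' p|)⁺ := by simp only [posPart_def]; fun_prop
  have hi : ∀ F : ℝ × ℝ → ℝ, Continuous F → IntegrableOn F R := fun F hF =>
    integrableOn_Ioo_prod_Ioo hF _ _ _ _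
  have hi' : ∀ F : ℝ × ℝ → ℝ, Continuous F → IntegrableOn F R' := fun F hF =>
    integrableOn_Ioo_prod_Ioo hF _ _ _ _
  have hmn : ∀ p, m p ≤ n p + (A p + A' p.swap) := by
    intro p
    have h1 := hfw p
    have h2 := hgw p.swap
    have h3 := hA0 p
    have h4 := hA0' p.swap
    simp only [hm, hn]
    rw [← min_add_add_right]
    refine min_le_min ?_ ?_
    · linarith
    · linarith
  set K := G ∩ H' with hK
  have hKm : MeasurableSet K := hGm.inter hHm'
  have hKR : K ⊆ R := inter_subset_left.trans hGR
  -- the main term: `(f, g)` is injective on the selected set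
  have hmain : ∫ p in K, n p ^ 2 ≤ 4 * (3 * M + ε) * (3 * M' + ε) := by
    set F : ℝ × ℝ → ℝ × ℝ := fun p => (f p, g p.swap) with hF
    set F' : ℝ × ℝ → (ℝ × ℝ →L[ℝ] ℝ × ℝ) := fun p => (fderiv ℝ f p).prod
      ((fderiv ℝ g p.swap).comp ((ContinuousLinearMap.snd ℝ ℝ ℝ).prod
        (ContinuousLinearMap.fst ℝ ℝ ℝ))) with hF'
    have hFd : ∀ p ∈ K, HasFDerivWithinAt F (F' p) K p := by
      intro p _
      have h1 : HasFDerivAt (Prod.swap : ℝ × ℝ → ℝ × ℝ) ((ContinuousLinearMap.snd ℝ ℝ ℝ).prod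
        (ContinuousLinearMap.fst ℝ ℝ ℝ)) p := hasFDerivAt_snd.prodMk hasFDerivAt_fst
      exact ((hf.differentiable one_ne_zero p).hasFDerivAt.prodMk
        ((hg.differentiable one_ne_zero p.swap).hasFDerivAt.comp p h1)).hasFDerivWithinAt
    have hdet : ∀ p, (F' p).det = px f p * px g p.swap - py f p * py g p.swap := by
      intro p
      simp only [hF']
      rw [det_prod_clm]
      simp [px, py]
    have hFi : InjOn F K := by
      intro p hp q hq hpq
      simp only [hF, Prod.mk.injEq] at hpq
      have h1 := hGi p hp.1 q hq.1 hpq.1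
      have h2 := hHi p.swap hp.2 q.swap hq.2 hpq.2
      simp only [Prod.fst_swap, Prod.snd_swap] at h2
      have h3 : |p.1 - q.1| ≤ (1 - ε) * ((1 - ε) * |p.1 - q.1|) :=
        h2.trans (mul_le_mul_of_nonneg_left h1 (by linarith))
      have h4 : |p.1 - q.1| = 0 := by
        have h6 := abs_nonneg (p.1 - q.1)
        have h7 : (1 - ε) * ((1 - ε) * |p.1 - q.1|) ≤ (1 - ε) * |p.1 - q.1| :=
          mul_le_mul_of_nonneg_left (mul_le_of_le_one_left h6 (by linarith)) (by linarith)
        have h8 : ε * |p.1 - q.1| ≤ 0 := by linarith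
        exact le_antisymm (nonpos_of_mul_nonpos_right h8 hε) h6
      rw [h4, mul_zero] at h1
      have h5 : |p.2 - q.2| = 0 := le_antisymm h1 (abs_nonneg _)
      rw [abs_eq_zero, sub_eq_zero] at h4 h5
      exact Prod.ext h4 h5
    have harea := lintegral_abs_det_fderiv_eq_addHaar_image volume hKm hFd hFi
    have himg : F '' K ⊆ Icc (-(3 * M + ε)) (3 * M + ε) ×ˢ Icc (-(3 * M' + ε)) (3 * M' + ε) := by
      rintro _ ⟨p, hp, rfl⟩
      exact ⟨abs_le.1 (hfM p hp.1), abs_le.1 (hgM p.swap hp.2)⟩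
    have hMn : 0 ≤ 3 * M + ε := by
      rw [hM]
      have : 0 ≤ ∫ p in Ioo a (a + 1) ×ˢ Ioo (b - 1) (b + 2),
        (|P p| + |Q p| + |px P p + py Q p|) := integral_nonneg fun p => by positivity
      positivity
    have hMn' : 0 ≤ 3 * M' + ε := by
      rw [hM']
      have : 0 ≤ ∫ p in Ioo b (b + 1) ×ˢ Ioo (a - 1) (a + 2),
        (|P' p| + |Q' p| + |px P' p + py Q' p|) := integral_nonneg fun p => by positivity
      positivity
    have hvol : volume (F '' K) ≤ ENNReal.ofReal (4 * (3 * M + ε) * (3 * M' + ε)) := by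
      refine (measure_mono himg).trans (le_of_eq ?_)
      rw [Measure.volume_eq_prod, Measure.prod_prod, Real.volume_Icc, Real.volume_Icc,
        ← ENNReal.ofReal_mul (by linarith)]
      congr 1
      ring
    have hle : ENNReal.ofReal (∫ p in K, n p ^ 2) ≤ ∫⁻ p in K, ENNReal.ofReal |(F' p).det| := by
      rw [ofReal_integral_eq_lintegral_ofReal ((hi _ (by fun_prop)).mono_set hKR)
        (Eventually.of_forall fun p => sq_nonneg _)]
      refine lintegral_mono fun p => ENNReal.ofReal_le_ofReal ?_
      rw [hdet]
      exact min_posPart_sq_le_abs_det (by linarith) (by linarith) (hfy p).le (hgy p.swap).le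
    rw [harea] at hle
    exact (ENNReal.ofReal_le_ofReal_iff (by positivity)).1 (hle.trans hvol)
  have hCS : ∫ p in K, χ p * n p ≤
      √(∫ p in R, χ p ^ 2) * √(4 * (3 * M + ε) * (3 * M' + ε)) := by
    have hL2 : ∀ F : ℝ × ℝ → ℝ, Continuous F → MemLp F 2 (volume.restrict K) := fun F hF =>
      (memLp_two_iff_integrable_sq hF.aestronglyMeasurable).2
        ((hi _ (hF.pow 2)).mono_set hKR)
    refine (integral_mul_le_sqrt_mul_sqrt (Eventually.of_forall fun p => (hχ01 p).1)
      (Eventually.of_forall hn0) (hL2 _ hχ) (hL2 _ hnc)).trans ?_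
    refine mul_le_mul (Real.sqrt_le_sqrt ?_) (Real.sqrt_le_sqrt hmain) (Real.sqrt_nonneg _)
      (Real.sqrt_nonneg _)
    exact setIntegral_mono_set (hi _ (hχ.pow 2)) (Eventually.of_forall fun p => sq_nonneg _)
      (LE.le.eventuallyLE hKR)
  have hχm : ∀ p, χ p * m p ≤ m p := fun p => mul_le_of_le_one_left (hm0 p) (hχ01 p).2
  have hsplit : ∫ p in R, χ p * m p ≤ (∫ p in K, χ p * m p) + (∫ p in R \ G, (P p - |Q p|)⁺) +
      ∫ p in R \ H', (P' p.swap - |Q' p.swap|)⁺ := by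
    have c0 : Continuous fun p => χ p * m p := by fun_prop
    have c1 : Continuous fun p : ℝ × ℝ => (P' p.swap - |Q' p.swap|)⁺ := hTP.comp continuous_swap
    rw [← integral_inter_add_sdiff hGm (hi _ c0), inter_eq_self_of_subset_right hGR,
      ← integral_inter_add_sdiff hHm' ((hi _ c0).mono_set hGR)]
    have e1 : ∫ p in R \ G, χ p * m p ≤ ∫ p in R \ G, (P p - |Q p|)⁺ :=
      setIntegral_mono ((hi _ c0).mono_set sdiff_subset) ((hi _ hSP).mono_set sdiff_subset)
        fun p => (hχm p).trans (min_le_left _ _)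
    have e2 : ∫ p in G \ H', χ p * m p ≤ ∫ p in R \ H', (P' p.swap - |Q' p.swap|)⁺ := by
      refine (setIntegral_mono (g := fun p : ℝ × ℝ => (P' p.swap - |Q' p.swap|)⁺)
        ((hi _ c0).mono_set (sdiff_subset.trans hGR)) ((hi _ c1).mono_set (sdiff_subset.trans hGR))
        fun p => (hχm p).trans (min_le_right _ _)).trans ?_
      exact setIntegral_mono_set ((hi _ c1).mono_set sdiff_subset)
        (Eventually.of_forall fun p => posPart_nonneg _)
        (LE.le.eventuallyLE (sdiff_subset_sdiff_left hGR))
    linarith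
  have hKint : ∫ p in K, χ p * m p ≤
      (∫ p in K, χ p * n p) + ((∫ p in R, A p) + ∫ p in R', A' p) := by
    have c1 : Continuous fun p => χ p * m p := by fun_prop
    have c2 : Continuous fun p => χ p * n p := by fun_prop
    have c3 : Continuous fun p : ℝ × ℝ => A' p.swap := hAc'.comp continuous_swap
    have c4 : Continuous fun p : ℝ × ℝ => A p + A' p.swap := hAc.add c3
    calc ∫ p in K, χ p * m p ≤ ∫ p in K, (χ p * n p + (A p + A' p.swap)) := by
          refine setIntegral_mono ((hi _ c1).mono_set hKR) ((hi _ (c2.add c4)).mono_set hKR)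
            fun p => ?_
          have h1 := mul_le_mul_of_nonneg_left (hmn p) (hχ01 p).1
          have h2 := mul_le_of_le_one_left (add_nonneg (hA0 p) (hA0' p.swap)) (hχ01 p).2
          simp only
          linarith
      _ = (∫ p in K, χ p * n p) + ∫ p in K, (A p + A' p.swap) :=
          integral_add ((hi _ c2).mono_set hKR) ((hi _ c4).mono_set hKR)
      _ ≤ (∫ p in K, χ p * n p) + ∫ p in R, (A p + A' p.swap) := by
          refine add_le_add le_rfl (setIntegral_mono_set (hi _ c4)
            (Eventually.of_forall fun p => add_nonneg (hA0 p) (hA0' p.swap))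
            (LE.le.eventuallyLE hKR))
      _ = _ := by
          rw [integral_add (hi _ hAc) (hi _ c3)]
          congr 2
          rw [← hRR']
          exact setIntegral_preimage_swap A' R'
  have hAint : ∫ p in R, A p = (∫ p in R, |px f p + Q p|) + ε * ∫ p in R, (P p + 1) := by
    simp only [hA]
    rw [integral_add (hi _ (by fun_prop)) (hi _ (by fun_prop)), integral_const_mul]
  have hAint' : ∫ p in R', A' p = (∫ p in R', |px g p + Q' p|) + ε * ∫ p in R', (P' p + 1) := by
    simp only [hA']
    rw [integral_add (hi' _ (by fun_prop)) (hi' _ (by fun_prop)), integral_const_mul]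
  have hswap : ∫ p in R \ H', (P' p.swap - |Q' p.swap|)⁺ = ∫ p in R' \ H, (P' p - |Q' p|)⁺ := by
    rw [← hRR', hH', ← preimage_sdiff]
    exact setIntegral_preimage_swap (fun p => (P' p - |Q' p|)⁺) (R' \ H)
  change ∫ p in R, χ p * m p ≤ _
  linarith

/-- The estimate on a unit square. The second field is written in swapped coordinates, so that both
fields are nonnegative in their first component. -/
theorem square_estimate (hP : ContDiff ℝ 1 P) (hQ : ContDiff ℝ 1 Q) (hP0 : ∀ p, 0 ≤ P p)
    (hP' : ContDiff ℝ 1 P') (hQ' : ContDiff ℝ 1 Q') (hP0' : ∀ p, 0 ≤ P' p)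
    (hχ : Continuous χ) (hχ01 : ∀ p, χ p ∈ Icc (0 : ℝ) 1) (a b : ℝ) :
    ∫ p in Ioo a (a + 1) ×ˢ Ioo b (b + 1),
        χ p * min ((P p - |Q p|)⁺) ((P' p.swap - |Q' p.swap|)⁺) ≤
      6 * √(∫ p in Ioo a (a + 1) ×ˢ Ioo b (b + 1), χ p ^ 2) *
        √((∫ p in Ioo a (a + 1) ×ˢ Ioo (b - 1) (b + 2), (|P p| + |Q p| + |px P p + py Q p|)) *
          ∫ p in Ioo b (b + 1) ×ˢ Ioo (a - 1) (a + 2), (|P' p| + |Q' p| + |px P' p + py Q' p|)) +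
      ((∫ p in Ioo a (a + 1) ×ˢ Ioo b (b + 1), (P p - |Q p|)⁻) +
      (∫ p in Ioo b (b + 1) ×ˢ Ioo a (a + 1), (P' p - |Q' p|)⁻) +
      2 * (∫ p in Ioo a (a + 1) ×ˢ Ioo b (b + 1), |px P p + py Q p|) +
      2 * ∫ p in Ioo b (b + 1) ×ˢ Ioo a (a + 1), |px P' p + py Q' p|) := by
  set M := ∫ p in Ioo a (a + 1) ×ˢ Ioo (b - 1) (b + 2), (|P p| + |Q p| + |px P p + py Q p|) with hM
  set M' := ∫ p in Ioo b (b + 1) ×ˢ Ioo (a - 1) (a + 2), (|P' p| + |Q' p| + |px P' p + py Q' p|)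
    with hM'
  set X := √(∫ p in Ioo a (a + 1) ×ˢ Ioo b (b + 1), χ p ^ 2)
  set N := ∫ p in Ioo a (a + 1) ×ˢ Ioo b (b + 1), (P p - |Q p|)⁻
  set N' := ∫ p in Ioo b (b + 1) ×ˢ Ioo a (a + 1), (P' p - |Q' p|)⁻
  set D := ∫ p in Ioo a (a + 1) ×ˢ Ioo b (b + 1), |px P p + py Q p|
  set D' := ∫ p in Ioo b (b + 1) ×ˢ Ioo a (a + 1), |px P' p + py Q' p|
  set J := ∫ p in Ioo a (a + 1) ×ˢ Ioo b (b + 1), (P p + 1)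
  set J' := ∫ p in Ioo b (b + 1) ×ˢ Ioo a (a + 1), (P' p + 1)
  have hlim : Tendsto (fun ε : ℝ => X * √(4 * (3 * M + ε) * (3 * M' + ε)) +
      (N + N' + 2 * (D + ε * J) + 2 * (D' + ε * J'))) (𝓝[>] 0)
      (𝓝 (X * √(4 * (3 * M + 0) * (3 * M' + 0)) +
      (N + N' + 2 * (D + 0 * J) + 2 * (D' + 0 * J')))) := by
    refine Tendsto.mono_left (Continuous.tendsto ?_ 0) nhdsWithin_le_nhds
    fun_prop
  have hle := ge_of_tendsto hlim (b := ∫ p in Ioo a (a + 1) ×ˢ Ioo b (b + 1),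
        χ p * min ((P p - |Q p|)⁺) ((P' p.swap - |Q' p.swap|)⁺)) (by
    filter_upwards [Ioo_mem_nhdsGT one_pos] with ε hε
    exact square_estimate_aux hP hQ hP0 hP' hQ' hP0' hχ hχ01 a b hε.1 hε.2 hM hM')
  have hsq : √(4 * (3 * M + 0) * (3 * M' + 0)) = 6 * √(M * M') := by
    rw [show 4 * (3 * M + 0) * (3 * M' + 0) = 6 ^ 2 * (M * M') by ring,
      Real.sqrt_mul (by norm_num), Real.sqrt_sq (by norm_num)]
  rw [hsq] at hle
  linarith

/-! ### Summation over the unit squares of the plane -/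

theorem sum_setIntegral_le_mul_integral {α ι : Type*} [MeasurableSpace α] {μ : Measure α}
    (F : Finset ι) {A : ι → Set α} (hA : ∀ i, MeasurableSet (A i)) {k : ℕ} (J : α → Finset ι)
    (hJ : ∀ p i, p ∈ A i → i ∈ J p) (hk : ∀ p, (J p).card ≤ k) {h : α → ℝ} (h0 : ∀ p, 0 ≤ h p)
    (hi : Integrable h μ) :
    ∑ i ∈ F, ∫ p in A i, h p ∂μ ≤ k * ∫ p, h p ∂μ := by
  classical
  simp_rw [← integral_indicator (hA _)]
  rw [← integral_finsetSum _ fun i _ => hi.indicator (hA i), ← integral_const_mul]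
  refine integral_mono (integrable_finsetSum _ fun i _ => hi.indicator (hA i)) (hi.const_mul _)
    fun p => ?_
  simp only
  calc ∑ i ∈ F, (A i).indicator h p = ∑ i ∈ F with p ∈ A i, h p := by
        rw [Finset.sum_filter]
        exact Finset.sum_congr rfl fun i _ => by rw [indicator_apply]
    _ = (F.filter fun i => p ∈ A i).card * h p := by rw [Finset.sum_const, nsmul_eq_mul]
    _ ≤ k * h p := by
        refine mul_le_mul_of_nonneg_right ?_ (h0 p)
        have h1 : (F.filter fun i => p ∈ A i).card ≤ (J p).card :=
          Finset.card_le_card fun i hi => hJ p i (Finset.mem_filter.1 hi).2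
        exact_mod_cast h1.trans (hk p)

/-- The open unit square with lower left corner `n`. -/
def unitSquare (n : ℤ × ℤ) : Set (ℝ × ℝ) := Ioo (n.1 : ℝ) (n.1 + 1) ×ˢ Ioo (n.2 : ℝ) (n.2 + 1)

theorem measurableSet_unitSquare (n : ℤ × ℤ) : MeasurableSet (unitSquare n) :=
  measurableSet_Ioo.prod measurableSet_Ioo

theorem floor_eq_of_mem_Ioo {t : ℝ} {k : ℤ} (h : t ∈ Ioo (k : ℝ) (k + 1)) : ⌊t⌋ = k :=
  Int.floor_eq_iff.2 ⟨h.1.le, h.2⟩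

theorem sum_setIntegral_unitSquare_le (F : Finset (ℤ × ℤ)) {h : ℝ × ℝ → ℝ} (h0 : ∀ p, 0 ≤ h p)
    (hi : Integrable h) : ∑ n ∈ F, ∫ p in unitSquare n, h p ≤ ∫ p, h p := by
  have := sum_setIntegral_le_mul_integral (k := 1) F measurableSet_unitSquare
    (fun p => {(⌊p.1⌋, ⌊p.2⌋)})
    (fun p n hp => Finset.mem_singleton.2
      (Prod.ext (floor_eq_of_mem_Ioo hp.1).symm (floor_eq_of_mem_Ioo hp.2).symm))
    (fun p => by simp) h0 hi
  simpa using this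

/-- The rectangles obtained from the unit squares by tripling their height overlap three times. -/
theorem sum_setIntegral_tripled_le {ι : Type*} (F : Finset ι) (c : ι ≃ ℤ × ℤ) {h : ℝ × ℝ → ℝ}
    (h0 : ∀ p, 0 ≤ h p) (hi : Integrable h) :
    ∑ i ∈ F, ∫ p in Ioo ((c i).1 : ℝ) ((c i).1 + 1) ×ˢ Ioo ((c i).2 - 1 : ℝ) ((c i).2 + 2), h p ≤
      3 * ∫ p, h p := by
  classical
  have := sum_setIntegral_le_mul_integral (μ := volume) (k := 3) F
    (A := fun i => Ioo ((c i).1 : ℝ) ((c i).1 + 1) ×ˢ Ioo ((c i).2 - 1 : ℝ) ((c i).2 + 2))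
    (fun _ => measurableSet_Ioo.prod measurableSet_Ioo)
    (fun p => (({⌊p.1⌋} : Finset ℤ) ×ˢ Finset.Icc (⌊p.2⌋ - 1) (⌊p.2⌋ + 1)).map c.symm.toEmbedding)
    (fun p i hp => ?_) (fun p => ?_) h0 hi
  · simpa using this
  · rw [Finset.mem_map_equiv, Equiv.symm_symm, Finset.mem_product, Finset.mem_singleton,
      Finset.mem_Icc]
    have h1 : (c i).2 ≤ ⌊p.2⌋ + 1 := by
      have := hp.2.1
      rw [← sub_le_iff_le_add]
      exact Int.le_floor.2 (by push_cast; linarith)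
    have h2 : ⌊p.2⌋ ≤ (c i).2 + 1 := by
      have := hp.2.2
      rw [← Int.lt_add_one_iff, Int.floor_lt]
      push_cast
      linarith
    exact ⟨(floor_eq_of_mem_Ioo hp.1).symm, by omega, h1⟩
  · rw [Finset.card_map, Finset.card_product, Finset.card_singleton, Int.card_Icc]
    omega

theorem ae_mem_unitSquare_floor :
    ∀ᵐ p : ℝ × ℝ, p ∈ unitSquare (⌊p.1⌋, ⌊p.2⌋) := by
  have hc : ∀ᵐ t : ℝ, t ∉ range ((↑) : ℤ → ℝ) := (countable_range _).ae_notMem _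
  have h1 : ∀ᵐ p : ℝ × ℝ, p.1 ∉ range ((↑) : ℤ → ℝ) := by
    rw [Measure.volume_eq_prod]; exact Measure.quasiMeasurePreserving_fst.ae hc
  have h2 : ∀ᵐ p : ℝ × ℝ, p.2 ∉ range ((↑) : ℤ → ℝ) := by
    rw [Measure.volume_eq_prod]; exact Measure.quasiMeasurePreserving_snd.ae hc
  have key : ∀ t : ℝ, t ∉ range ((↑) : ℤ → ℝ) → t ∈ Ioo (⌊t⌋ : ℝ) (⌊t⌋ + 1) := fun t ht =>
    ⟨lt_of_le_of_ne (Int.floor_le t) fun h => ht ⟨_, h⟩, Int.lt_floor_add_one t⟩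
  filter_upwards [h1, h2] with p hp1 hp2
  exact ⟨key _ hp1, key _ hp2⟩

variable {P Q P' Q' χ : ℝ × ℝ → ℝ}

/-- The estimate for continuously differentiable fields on the plane, the second of them in swapped
coordinates. -/
theorem smooth_estimate (hP : ContDiff ℝ 1 P) (hQ : ContDiff ℝ 1 Q) (hP0 : ∀ p, 0 ≤ P p)
    (hPi : Integrable P) (hQi : Integrable Q) (hDi : Integrable fun p => px P p + py Q p)
    (hP' : ContDiff ℝ 1 P') (hQ' : ContDiff ℝ 1 Q') (hP0' : ∀ p, 0 ≤ P' p)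
    (hPi' : Integrable P') (hQi' : Integrable Q') (hDi' : Integrable fun p => px P' p + py Q' p)
    (hχ : Continuous χ) (hχc : HasCompactSupport χ) (hχ01 : ∀ p, χ p ∈ Icc (0 : ℝ) 1) :
    ∫ p, χ p * min ((P p - |Q p|)⁺) ((P' p.swap - |Q' p.swap|)⁺) ≤
      18 * √(∫ p, χ p ^ 2) *
        (√(∫ p, (|P p| + |Q p| + |px P p + py Q p|)) *
          √(∫ p, (|P' p| + |Q' p| + |px P' p + py Q' p|))) +
      ((∫ p, (P p - |Q p|)⁻) + (∫ p, (P' p - |Q' p|)⁻) +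
      2 * (∫ p, |px P p + py Q p|) + 2 * ∫ p, |px P' p + py Q' p|) := by
  have hPc := hP.continuous
  have hQc := hQ.continuous
  have hPc' := hP'.continuous
  have hQc' := hQ'.continuous
  set m : ℝ × ℝ → ℝ := fun p => min ((P p - |Q p|)⁺) ((P' p.swap - |Q' p.swap|)⁺) with hm
  have hm0 : ∀ p, 0 ≤ m p := fun p => le_min (posPart_nonneg _) (posPart_nonneg _)
  have hmc : Continuous m := by simp only [hm, posPart_def]; fun_prop
  have hχmi : Integrable fun p => χ p * m p :=
    (hχ.mul hmc).integrable_of_hasCompactSupport hχc.mul_right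
  have hχ2i : Integrable fun p => χ p ^ 2 := by
    simp_rw [sq]
    exact (hχ.mul hχ).integrable_of_hasCompactSupport hχc.mul_right
  set h : ℝ × ℝ → ℝ := fun p => |P p| + |Q p| + |px P p + py Q p| with hh
  set h' : ℝ × ℝ → ℝ := fun p => |P' p| + |Q' p| + |px P' p + py Q' p| with hh'
  have hhi : Integrable h := (hPi.abs.add hQi.abs).add hDi.abs
  have hhi' : Integrable h' := (hPi'.abs.add hQi'.abs).add hDi'.abs
  have hh0 : ∀ p, 0 ≤ h p := fun p => by simp only [hh]; positivity
  have hh0' : ∀ p, 0 ≤ h' p := fun p => by simp only [hh']; positivity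
  have hN : Integrable fun p => (P p - |Q p|)⁻ := (hPi.sub hQi.abs).neg_part
  have hN' : Integrable fun p => (P' p - |Q' p|)⁻ := (hPi'.sub hQi'.abs).neg_part
  -- finitely many unit squares cover the support of `χ` up to a null set
  obtain ⟨r, hr⟩ : ∃ r : ℕ, ∀ p, χ p ≠ 0 → |p.1| ≤ r ∧ |p.2| ≤ r := by
    obtain ⟨r, hr⟩ := hχc.isBounded.exists_norm_le
    obtain ⟨k, hk⟩ := exists_nat_ge r
    refine ⟨k, fun p hp => ?_⟩
    have h1 := (hr p (subset_tsupport _ hp)).trans hk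
    exact ⟨(norm_fst_le p).trans h1, (norm_snd_le p).trans h1⟩
  set F : Finset (ℤ × ℤ) := Finset.Icc (-(r : ℤ)) r ×ˢ Finset.Icc (-(r : ℤ)) r with hF
  have hmemF : ∀ t : ℝ, |t| ≤ r → ⌊t⌋ ∈ Finset.Icc (-(r : ℤ)) r := by
    intro t ht
    rw [abs_le] at ht
    rw [Finset.mem_Icc]
    refine ⟨Int.le_floor.2 (by push_cast; linarith), ?_⟩
    have := (Int.floor_le t).trans ht.2
    exact_mod_cast this
  have hcover : ∫ p, χ p * m p ≤ ∑ n ∈ F, ∫ p in unitSquare n, χ p * m p := by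
    simp_rw [← integral_indicator (measurableSet_unitSquare _)]
    rw [← integral_finsetSum _ fun n _ => hχmi.indicator (measurableSet_unitSquare n)]
    refine integral_mono_ae hχmi
      (integrable_finsetSum _ fun n _ => hχmi.indicator (measurableSet_unitSquare n)) ?_
    filter_upwards [ae_mem_unitSquare_floor] with p hp
    have hnn : ∀ n ∈ F, 0 ≤ (unitSquare n).indicator (fun p => χ p * m p) p := fun n _ =>
      indicator_nonneg (fun q _ => mul_nonneg (hχ01 q).1 (hm0 q)) p
    by_cases hp0 : χ p = 0
    · simp only [hp0, zero_mul]
      exact Finset.sum_nonneg hnn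
    · have hpF : (⌊p.1⌋, ⌊p.2⌋) ∈ F :=
        Finset.mem_product.2 ⟨hmemF _ (hr p hp0).1, hmemF _ (hr p hp0).2⟩
      have := Finset.single_le_sum hnn hpF
      rwa [indicator_of_mem hp] at this
  set X : ℤ × ℤ → ℝ := fun n => ∫ p in unitSquare n, χ p ^ 2 with hX
  set M : ℤ × ℤ → ℝ := fun n =>
    ∫ p in Ioo (n.1 : ℝ) (n.1 + 1) ×ˢ Ioo (n.2 - 1 : ℝ) (n.2 + 2), h p with hM
  set M' : ℤ × ℤ → ℝ := fun n =>
    ∫ p in Ioo (n.2 : ℝ) (n.2 + 1) ×ˢ Ioo (n.1 - 1 : ℝ) (n.1 + 2), h' p with hM'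
  have hX0 : ∀ n, 0 ≤ X n := fun n => integral_nonneg fun p => sq_nonneg _
  have hM0 : ∀ n, 0 ≤ M n := fun n => integral_nonneg hh0
  have hM0' : ∀ n, 0 ≤ M' n := fun n => integral_nonneg hh0'
  have hsq : ∀ n ∈ F, ∫ p in unitSquare n, χ p * m p ≤ 6 * (√(X n) * √(M n * M' n)) +
      ((∫ p in unitSquare n, (P p - |Q p|)⁻) + (∫ p in unitSquare n.swap, (P' p - |Q' p|)⁻) +
      2 * (∫ p in unitSquare n, |px P p + py Q p|) +
      2 * ∫ p in unitSquare n.swap, |px P' p + py Q' p|) := by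
    intro n _
    have := square_estimate hP hQ hP0 hP' hQ' hP0' hχ hχ01 n.1 n.2
    rw [mul_assoc] at this
    exact this
  have hsum := hcover.trans (Finset.sum_le_sum hsq)
  simp only [Finset.sum_add_distrib, ← Finset.mul_sum] at hsum
  have hswap : ∀ u : ℝ × ℝ → ℝ, (∀ p, 0 ≤ u p) → Integrable u →
      ∑ n ∈ F, ∫ p in unitSquare n.swap, u p ≤ ∫ p, u p := by
    intro u u0 ui
    have := sum_setIntegral_unitSquare_le (F.map (Equiv.prodComm ℤ ℤ).toEmbedding) u0 ui
    rwa [Finset.sum_map] at this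
  have e1 := sum_setIntegral_unitSquare_le F (fun p => negPart_nonneg (P p - |Q p|)) hN
  have e2 := hswap _ (fun p => negPart_nonneg (P' p - |Q' p|)) hN'
  have e3 := sum_setIntegral_unitSquare_le F (fun p => abs_nonneg (px P p + py Q p)) hDi.abs
  have e4 := hswap _ (fun p => abs_nonneg (px P' p + py Q' p)) hDi'.abs
  have e5 : ∑ n ∈ F, √(X n) * √(M n * M' n) ≤
      √(∫ p, χ p ^ 2) * (3 * (√(∫ p, h p) * √(∫ p, h' p))) := by
    have s1 : ∑ n ∈ F, X n ≤ ∫ p, χ p ^ 2 :=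
      sum_setIntegral_unitSquare_le F (fun p => sq_nonneg _) hχ2i
    have s2 : ∑ n ∈ F, M n ≤ 3 * ∫ p, h p :=
      sum_setIntegral_tripled_le F (Equiv.refl _) hh0 hhi
    have s3 : ∑ n ∈ F, M' n ≤ 3 * ∫ p, h' p :=
      sum_setIntegral_tripled_le F (Equiv.prodComm ℤ ℤ) hh0' hhi'
    have s4 : ∑ n ∈ F, M n * M' n ≤ (3 * ∫ p, h p) * (3 * ∫ p, h' p) := by
      calc ∑ n ∈ F, M n * M' n ≤ ∑ n ∈ F, M n * ∑ k ∈ F, M' k :=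
            Finset.sum_le_sum fun n hn => mul_le_mul_of_nonneg_left
              (Finset.single_le_sum (fun k _ => hM0' k) hn) (hM0 n)
        _ = (∑ n ∈ F, M n) * ∑ k ∈ F, M' k := by rw [Finset.sum_mul]
        _ ≤ _ := mul_le_mul s2 s3 (Finset.sum_nonneg fun n _ => hM0' n)
            (mul_nonneg (by norm_num) (integral_nonneg hh0))
    refine (Real.sum_sqrt_mul_sqrt_le F hX0 fun n => mul_nonneg (hM0 n) (hM0' n)).trans ?_
    refine mul_le_mul (Real.sqrt_le_sqrt s1) ?_ (Real.sqrt_nonneg _) (Real.sqrt_nonneg _)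
    refine (Real.sqrt_le_sqrt s4).trans (le_of_eq ?_)
    rw [show (3 * ∫ p, h p) * (3 * ∫ p, h' p) = 3 ^ 2 * ((∫ p, h p) * ∫ p, h' p) by ring,
      Real.sqrt_mul (by norm_num), Real.sqrt_sq (by norm_num),
      Real.sqrt_mul (integral_nonneg hh0)]
  linarith

/-! ### Mollification of measures with integrable densities -/

/-- The mollification `p ↦ ∫ s(q) g(p - q) dm(q)` of the measure with density `s` with respect to
`m`, by the kernel `g`. -/
def mollify (m : Measure (ℝ × ℝ)) (g s : ℝ × ℝ → ℝ) (p : ℝ × ℝ) : ℝ := ∫ q, s q * g (p - q) ∂m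

variable {m : Measure (ℝ × ℝ)} {g s : ℝ × ℝ → ℝ}

theorem exists_bound_of_hasCompactSupport (hg : Continuous g) (hgc : HasCompactSupport g) :
    ∃ B, ∀ p, |g p| ≤ B := by
  obtain ⟨B, hB⟩ := hgc.exists_bound_of_continuous hg
  exact ⟨B, hB⟩

theorem integrable_mollify_integrand (hs : Integrable s m) (hg : Continuous g)
    (hgc : HasCompactSupport g) (p : ℝ × ℝ) : Integrable (fun q => s q * g (p - q)) m := by
  obtain ⟨B, hB⟩ := exists_bound_of_hasCompactSupport hg hgc
  have hc : Continuous fun q => g (p - q) := by fun_prop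
  exact hs.mul_bdd (c := B) hc.aestronglyMeasurable (Eventually.of_forall fun q => hB _)

theorem continuous_mollify (hs : Integrable s m) (hg : Continuous g) (hgc : HasCompactSupport g) :
    Continuous (mollify m g s) := by
  obtain ⟨B, hB⟩ := exists_bound_of_hasCompactSupport hg hgc
  refine continuous_of_dominated (bound := fun q => |s q| * B) ?_ ?_ (hs.abs.mul_const B) ?_
  · exact fun p => (integrable_mollify_integrand hs hg hgc p).aestronglyMeasurable
  · refine fun p => Eventually.of_forall fun q => ?_
    rw [Real.norm_eq_abs, abs_mul]
    exact mul_le_mul_of_nonneg_left (hB _) (abs_nonneg _)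
  · exact Eventually.of_forall fun q => by fun_prop

theorem hasCompactSupport_px (hgc : HasCompactSupport g) : HasCompactSupport (px g) :=
  (hgc.fderiv ℝ).comp_left (g := fun L : ℝ × ℝ →L[ℝ] ℝ => L (1, 0)) rfl

theorem hasCompactSupport_py (hgc : HasCompactSupport g) : HasCompactSupport (py g) :=
  (hgc.fderiv ℝ).comp_left (g := fun L : ℝ × ℝ →L[ℝ] ℝ => L (0, 1)) rfl

theorem contDiff_mollify (hs : Integrable s m) (hg : ContDiff ℝ 1 g) (hgc : HasCompactSupport g) :
    ContDiff ℝ 1 (mollify m g s) ∧ px (mollify m g s) = mollify m (px g) s ∧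
      py (mollify m g s) = mollify m (py g) s := by
  have hx := continuous_px hg
  have hy := continuous_py hg
  have hxc := hasCompactSupport_px hgc
  have hyc := hasCompactSupport_py hgc
  have key : ∀ (γ : ℝ → ℝ × ℝ) (γ' : ℝ × ℝ → ℝ), Continuous γ' → HasCompactSupport γ' →
      (∀ t q, HasDerivAt (fun t => g (γ t - q)) (γ' (γ t - q)) t) → ∀ t,
      HasDerivAt (fun t => mollify m g s (γ t)) (mollify m γ' s (γ t)) t := by
    intro γ γ' hγ hγc hd t
    obtain ⟨B, hB⟩ := exists_bound_of_hasCompactSupport hγ hγc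
    refine (hasDerivAt_integral_of_dominated_loc_of_deriv_le (F := fun t q => s q * g (γ t - q))
      (F' := fun t q => s q * γ' (γ t - q)) (bound := fun q => |s q| * B)
      (univ_mem (f := 𝓝 t)) ?_ ?_ ?_ ?_ (hs.abs.mul_const B) ?_).2
    · exact Eventually.of_forall fun t =>
        (integrable_mollify_integrand hs hg.continuous hgc _).aestronglyMeasurable
    · exact integrable_mollify_integrand hs hg.continuous hgc _
    · exact (integrable_mollify_integrand hs hγ hγc _).aestronglyMeasurable
    · refine Eventually.of_forall fun q t _ => ?_
      rw [Real.norm_eq_abs, abs_mul]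
      exact mul_le_mul_of_nonneg_left (hB _) (abs_nonneg _)
    · exact Eventually.of_forall fun q t _ => (hd t q).const_mul (s q)
  refine contDiff_of_partials (continuous_mollify hs hx hxc) (continuous_mollify hs hy hyc)
    (fun x y => key (fun t => (t, y)) _ hx hxc (fun t q => ?_) x)
    (fun x y => key (fun t => (x, t)) _ hy hyc (fun t q => ?_) y)
  · exact (hasDerivAt_slice_fst hg (t - q.1) (y - q.2)).comp_sub_const t q.1
  · exact (hasDerivAt_slice_snd hg (x - q.1) (t - q.2)).comp_sub_const t q.2

/-- Testing a mollified measure against a bounded continuous function. -/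
theorem integral_mul_mollify [SFinite m] (hs : Integrable s m) (hg : Continuous g)
    (hgc : HasCompactSupport g) {ψ : ℝ × ℝ → ℝ} (hψ : Continuous ψ) {B : ℝ} (hB : ∀ p, |ψ p| ≤ B) :
    Integrable (fun p => ψ p * mollify m g s p) ∧
      ∫ p, ψ p * mollify m g s p = ∫ q, s q * (∫ p, ψ p * g (p - q)) ∂m := by
  have hgi : Integrable g := hg.integrable_of_hasCompactSupport hgc
  have hint : Integrable (fun z : (ℝ × ℝ) × (ℝ × ℝ) => ψ z.1 * (s z.2 * g (z.1 - z.2)))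
      ((volume : Measure (ℝ × ℝ)).prod m) := by
    have hmeas : AEStronglyMeasurable (fun z : (ℝ × ℝ) × (ℝ × ℝ) => s z.2 * g (z.1 - z.2))
        ((volume : Measure (ℝ × ℝ)).prod m) :=
      hs.aestronglyMeasurable.comp_snd.mul
        (Continuous.aestronglyMeasurable (by fun_prop))
    have h1 : Integrable (fun z : (ℝ × ℝ) × (ℝ × ℝ) => s z.2 * g (z.1 - z.2))
        ((volume : Measure (ℝ × ℝ)).prod m) := by
      rw [integrable_prod_iff' hmeas]
      refine ⟨Eventually.of_forall fun q => (hgi.comp_sub_right q).const_mul (s q), ?_⟩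
      have : (fun q => ∫ p, ‖s q * g (p - q)‖) = fun q => |s q| * ∫ p, |g p| := by
        funext q
        simp_rw [norm_mul, Real.norm_eq_abs]
        rw [integral_const_mul, integral_sub_right_eq_self (fun p => |g p|)]
      simp only [this]
      exact hs.abs.mul_const _
    refine Integrable.bdd_mul (c := B) h1 (Continuous.aestronglyMeasurable (by fun_prop))
      (Eventually.of_forall fun z => hB _)
  have hl : ∀ p, ψ p * mollify m g s p = ∫ q, ψ p * (s q * g (p - q)) ∂m := fun p => by
    rw [mollify, integral_const_mul]
  simp_rw [hl]
  refine ⟨hint.integral_prod_left, ?_⟩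
  rw [integral_integral_swap hint]
  refine integral_congr_ae (Eventually.of_forall fun q => ?_)
  simp only
  rw [← integral_const_mul]
  exact integral_congr_ae (Eventually.of_forall fun p => by ring)

theorem integrable_mollify [SFinite m] (hs : Integrable s m) (hg : Continuous g)
    (hgc : HasCompactSupport g) : Integrable (mollify m g s) := by
  simpa using (integral_mul_mollify hs hg hgc (ψ := fun _ => 1) continuous_const (B := 1)
    (by simp)).1

theorem integral_mollify [SFinite m] (hs : Integrable s m) (hg : Continuous g)
    (hgc : HasCompactSupport g) (hg1 : ∫ p, g p = 1) : ∫ p, mollify m g s p = ∫ q, s q ∂m := by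
  have := (integral_mul_mollify hs hg hgc (ψ := fun _ => 1) continuous_const (B := 1)
    (by simp)).2
  simpa [integral_sub_right_eq_self (fun p => g p), hg1] using this

theorem mollify_mono {s' : ℝ × ℝ → ℝ} (hs : Integrable s m) (hs' : Integrable s' m)
    (hg : Continuous g) (hgc : HasCompactSupport g) (hg0 : ∀ p, 0 ≤ g p) (h : s ≤ᵐ[m] s')
    (p : ℝ × ℝ) : mollify m g s p ≤ mollify m g s' p := by
  refine integral_mono_ae (integrable_mollify_integrand hs hg hgc p)
    (integrable_mollify_integrand hs' hg hgc p) ?_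
  filter_upwards [h] with q hq
  exact mul_le_mul_of_nonneg_right hq (hg0 _)

theorem abs_mollify_le (hg0 : ∀ p, 0 ≤ g p) (p : ℝ × ℝ) :
    |mollify m g s p| ≤ mollify m g (fun q => |s q|) p := by
  refine (abs_integral_le_integral_abs).trans (le_of_eq ?_)
  refine integral_congr_ae (Eventually.of_forall fun q => ?_)
  simp only [abs_mul, abs_of_nonneg (hg0 _)]

theorem mollify_sub {s' : ℝ × ℝ → ℝ} (hs : Integrable s m) (hs' : Integrable s' m)
    (hg : Continuous g) (hgc : HasCompactSupport g) (p : ℝ × ℝ) :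
    mollify m g (fun q => s q - s' q) p = mollify m g s p - mollify m g s' p := by
  simp only [mollify, sub_mul]
  exact integral_sub (integrable_mollify_integrand hs hg hgc p)
    (integrable_mollify_integrand hs' hg hgc p)

theorem mollify_nonneg (hg0 : ∀ p, 0 ≤ g p) (h : 0 ≤ᵐ[m] s) (p : ℝ × ℝ) :
    0 ≤ mollify m g s p := by
  refine integral_nonneg_of_ae ?_
  filter_upwards [h] with q hq
  exact mul_nonneg hq (hg0 _)

theorem integral_abs_mollify_le [SFinite m] (hs : Integrable s m) (hg : Continuous g)
    (hgc : HasCompactSupport g) (hg0 : ∀ p, 0 ≤ g p) (hg1 : ∫ p, g p = 1) :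
    ∫ p, |mollify m g s p| ≤ ∫ q, |s q| ∂m := by
  rw [← integral_mollify hs.abs hg hgc hg1]
  exact integral_mono (integrable_mollify hs hg hgc).abs (integrable_mollify hs.abs hg hgc)
    fun p => abs_mollify_le hg0 p

theorem mollify_sub_abs_le {s' : ℝ × ℝ → ℝ} (hs : Integrable s m) (hs' : Integrable s' m)
    (hg : Continuous g) (hgc : HasCompactSupport g) (hg0 : ∀ p, 0 ≤ g p) (p : ℝ × ℝ) :
    mollify m g (fun q => s q - |s' q|) p ≤ mollify m g s p - |mollify m g s' p| := by
  rw [mollify_sub hs hs'.abs hg hgc]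
  exact sub_le_sub_left (abs_mollify_le hg0 p) _

/-- Mollification does not increase the integral of `(s - |s'|)⁻`, a convex function of the field.
-/
theorem integral_negPart_mollify_le [SFinite m] {s' : ℝ × ℝ → ℝ} (hs : Integrable s m)
    (hs' : Integrable s' m) (hg : Continuous g) (hgc : HasCompactSupport g) (hg0 : ∀ p, 0 ≤ g p)
    (hg1 : ∫ p, g p = 1) :
    ∫ p, (mollify m g s p - |mollify m g s' p|)⁻ ≤ ∫ q, (s q - |s' q|)⁻ ∂m := by
  have hn : Integrable (fun q => (s q - |s' q|)⁻) m := (hs.sub hs'.abs).neg_part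
  rw [← integral_mollify hn hg hgc hg1]
  refine integral_mono ?_ (integrable_mollify hn hg hgc) fun p => ?_
  · exact ((integrable_mollify hs hg hgc).sub (integrable_mollify hs' hg hgc).abs).neg_part
  · have h1 := mollify_sub_abs_le hs hs' hg hgc hg0 p
    have h2 : -mollify m g (fun q => s q - |s' q|) p ≤
        mollify m g (fun q => (s q - |s' q|)⁻) p := by
      have := mollify_mono (hs.sub hs'.abs).neg hn hg hgc hg0
        (Eventually.of_forall fun q => neg_le_negPart _) p
      refine le_trans (le_of_eq ?_) this
      simp only [mollify, Pi.neg_apply, Pi.sub_apply, neg_mul, integral_neg]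
    rw [negPart_def]
    exact sup_le (by linarith)
      (mollify_nonneg hg0 (Eventually.of_forall fun q => negPart_nonneg _) p)

/-- The weak formulation of `div (s₀, s₁) m = d m` for densities with respect to `m`. -/
def HasDensityDiv (m : Measure (ℝ × ℝ)) (s₀ s₁ d : ℝ × ℝ → ℝ) : Prop :=
  ∀ φ : ℝ × ℝ → ℝ, ContDiff ℝ ∞ φ → HasCompactSupport φ →
    (∫ q, px φ q * s₀ q ∂m) + (∫ q, py φ q * s₁ q ∂m) = - ∫ q, φ q * d q ∂m

theorem div_mollify {s₀ s₁ d : ℝ × ℝ → ℝ} (h : HasDensityDiv m s₀ s₁ d) (h₀ : Integrable s₀ m)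
    (h₁ : Integrable s₁ m) (hg : ContDiff ℝ ∞ g) (hgc : HasCompactSupport g) (p : ℝ × ℝ) :
    px (mollify m g s₀) p + py (mollify m g s₁) p = mollify m g d p := by
  have hg1 : ContDiff ℝ 1 g := hg.of_le (by exact_mod_cast le_top)
  rw [(contDiff_mollify h₀ hg1 hgc).2.1, (contDiff_mollify h₁ hg1 hgc).2.2]
  have hφ : ContDiff ℝ ∞ fun q => g (p - q) := by fun_prop
  have hφc : HasCompactSupport fun q => g (p - q) :=
    hgc.comp_homeomorph (Homeomorph.subLeft p)
  have hfd : ∀ q v, fderiv ℝ (fun q => g (p - q)) q v = - fderiv ℝ g (p - q) v := by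
    intro q v
    have h1 : HasFDerivAt g (fderiv ℝ g (p - q)) (p - q) :=
      (hg1.differentiable one_ne_zero _).hasFDerivAt
    have h2 : HasFDerivAt (fun q => g (p - q)) _ q := h1.comp q ((hasFDerivAt_id q).const_sub p)
    rw [h2.fderiv]
    simp
  have := h _ hφ hφc
  simp only [px, py, hfd, neg_mul, integral_neg] at this
  simp only [mollify, px, py]
  simp_rw [mul_comm (s₀ _), mul_comm (s₁ _), mul_comm (d _)]
  linarith

/-! ### Fields with integrable densities with respect to an arbitrary measure -/

theorem px_comp_swap {f : ℝ × ℝ → ℝ} (hf : ContDiff ℝ 1 f) (p : ℝ × ℝ) :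
    px (fun q => f q.swap) p = py f p.swap ∧ py (fun q => f q.swap) p = px f p.swap := by
  have h1 : HasFDerivAt (Prod.swap : ℝ × ℝ → ℝ × ℝ) ((ContinuousLinearMap.snd ℝ ℝ ℝ).prod
    (ContinuousLinearMap.fst ℝ ℝ ℝ)) p := hasFDerivAt_snd.prodMk hasFDerivAt_fst
  have h2 : HasFDerivAt (fun q : ℝ × ℝ => f q.swap) _ p :=
    (hf.differentiable one_ne_zero p.swap).hasFDerivAt.comp p h1
  simp [px, py, h2.fderiv]

theorem contDiff_comp_swap {f : ℝ × ℝ → ℝ} (hf : ContDiff ℝ 1 f) :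
    ContDiff ℝ 1 fun q : ℝ × ℝ => f q.swap :=
  hf.comp (contDiff_snd.prodMk contDiff_fst)

theorem measurePreserving_swap_plane :
    MeasurePreserving (Prod.swap : ℝ × ℝ → ℝ × ℝ) volume volume := by
  rw [Measure.volume_eq_prod]; exact Measure.measurePreserving_swap

theorem integrable_comp_swap {f : ℝ × ℝ → ℝ} (hf : Integrable f) :
    Integrable fun q : ℝ × ℝ => f q.swap :=
  measurePreserving_swap_plane.integrable_comp_of_integrable hf

theorem integral_comp_swap (f : ℝ × ℝ → ℝ) : ∫ p : ℝ × ℝ, f p.swap = ∫ p, f p := by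
  simpa using setIntegral_preimage_swap f univ

/-- The estimate for two continuously differentiable fields in common coordinates. -/
theorem smooth_estimate_common {S₀ S₁ T₀ T₁ χ : ℝ × ℝ → ℝ} (hS₀ : ContDiff ℝ 1 S₀)
    (hS₁ : ContDiff ℝ 1 S₁) (hS : ∀ p, 0 ≤ S₀ p) (hS₀i : Integrable S₀) (hS₁i : Integrable S₁)
    (hDi : Integrable fun p => px S₀ p + py S₁ p)
    (hT₀ : ContDiff ℝ 1 T₀) (hT₁ : ContDiff ℝ 1 T₁) (hT : ∀ p, 0 ≤ T₁ p) (hT₀i : Integrable T₀)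
    (hT₁i : Integrable T₁) (hEi : Integrable fun p => px T₀ p + py T₁ p)
    (hχ : Continuous χ) (hχc : HasCompactSupport χ) (hχ01 : ∀ p, χ p ∈ Icc (0 : ℝ) 1) :
    ∫ p, χ p * min ((S₀ p - |S₁ p|)⁺) ((T₁ p - |T₀ p|)⁺) ≤
      18 * √(∫ p, χ p ^ 2) *
        (√(∫ p, (|S₀ p| + |S₁ p| + |px S₀ p + py S₁ p|)) *
          √(∫ p, (|T₀ p| + |T₁ p| + |px T₀ p + py T₁ p|))) +
      ((∫ p, (S₀ p - |S₁ p|)⁻) + (∫ p, (T₁ p - |T₀ p|)⁻) +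
      2 * (∫ p, |px S₀ p + py S₁ p|) + 2 * ∫ p, |px T₀ p + py T₁ p|) := by
  have hdiv : ∀ p, px (fun q => T₁ q.swap) p + py (fun q => T₀ q.swap) p
      = px T₀ p.swap + py T₁ p.swap := fun p => by
    rw [(px_comp_swap hT₁ p).1, (px_comp_swap hT₀ p).2, add_comm]
  have := smooth_estimate hS₀ hS₁ hS hS₀i hS₁i hDi (contDiff_comp_swap hT₁)
    (contDiff_comp_swap hT₀) (fun p => hT _) (integrable_comp_swap hT₁i)
    (integrable_comp_swap hT₀i) (by simp only [hdiv]; exact integrable_comp_swap hEi) hχ hχc hχ01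
  simp only [hdiv, Prod.swap_swap] at this
  rw [integral_comp_swap (fun p => |T₁ p| + |T₀ p| + |px T₀ p + py T₁ p|),
    integral_comp_swap (fun p => (T₁ p - |T₀ p|)⁻),
    integral_comp_swap (fun p => |px T₀ p + py T₁ p|)] at this
  simpa only [add_comm |T₁ _|] using this

variable {m : Measure (ℝ × ℝ)} {s₀ s₁ d t₀ t₁ e χ : ℝ × ℝ → ℝ}

/-- The density `min (s₀ - |s₁|) (t₁ - |t₀|)`. Its positive part is the minimum of the positive
parts of the two entries. It is a concave function of the fields, so that its mollification is a
lower bound for the same expression in the mollified fields. -/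
def excess (s₀ s₁ t₀ t₁ : ℝ × ℝ → ℝ) (q : ℝ × ℝ) : ℝ :=
  min (s₀ q - |s₁ q|) (t₁ q - |t₀ q|)

theorem integrable_excess (hs₀ : Integrable s₀ m) (hs₁ : Integrable s₁ m) (ht₀ : Integrable t₀ m)
    (ht₁ : Integrable t₁ m) : Integrable (excess s₀ s₁ t₀ t₁) m :=
  (hs₀.sub hs₁.abs).inf (ht₁.sub ht₀.abs)

/-- The smooth estimate for the mollified fields, with both sides expressed by the densities. -/
theorem estimate_mollified [SFinite m] (hs₀ : Integrable s₀ m) (hs₁ : Integrable s₁ m)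
    (hd : Integrable d m) (ht₀ : Integrable t₀ m) (ht₁ : Integrable t₁ m) (he : Integrable e m)
    (hs : 0 ≤ᵐ[m] s₀) (ht : 0 ≤ᵐ[m] t₁) (hdiv : HasDensityDiv m s₀ s₁ d)
    (hdiv' : HasDensityDiv m t₀ t₁ e) (hχ : Continuous χ) (hχc : HasCompactSupport χ)
    (hχ01 : ∀ p, χ p ∈ Icc (0 : ℝ) 1) {g : ℝ × ℝ → ℝ} (hg : ContDiff ℝ ∞ g)
    (hgc : HasCompactSupport g) (hg0 : ∀ p, 0 ≤ g p) (hg1 : ∫ p, g p = 1) :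
    ∫ p, χ p * mollify m g (excess s₀ s₁ t₀ t₁) p ≤
      18 * √(∫ p, χ p ^ 2) *
        (√(∫ q, (|s₀ q| + |s₁ q| + |d q|) ∂m) * √(∫ q, (|t₀ q| + |t₁ q| + |e q|) ∂m)) +
      ((∫ q, (s₀ q - |s₁ q|)⁻ ∂m) + (∫ q, (t₁ q - |t₀ q|)⁻ ∂m) +
      2 * (∫ q, |d q| ∂m) + 2 * ∫ q, |e q| ∂m) := by
  have hgC : ContDiff ℝ 1 g := hg.of_le (by exact_mod_cast le_top)
  have hgk := hg.continuous
  have hD := div_mollify hdiv hs₀ hs₁ hg hgc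
  have hE := div_mollify hdiv' ht₀ ht₁ hg hgc
  have hDi : Integrable fun p => px (mollify m g s₀) p + py (mollify m g s₁) p := by
    simp only [hD]; exact integrable_mollify hd hgk hgc
  have hEi : Integrable fun p => px (mollify m g t₀) p + py (mollify m g t₁) p := by
    simp only [hE]; exact integrable_mollify he hgk hgc
  have key := smooth_estimate_common (contDiff_mollify hs₀ hgC hgc).1
    (contDiff_mollify hs₁ hgC hgc).1 (mollify_nonneg hg0 hs) (integrable_mollify hs₀ hgk hgc)
    (integrable_mollify hs₁ hgk hgc) hDi (contDiff_mollify ht₀ hgC hgc).1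
    (contDiff_mollify ht₁ hgC hgc).1 (mollify_nonneg hg0 ht) (integrable_mollify ht₀ hgk hgc)
    (integrable_mollify ht₁ hgk hgc) hEi hχ hχc hχ01
  simp only [hD, hE] at key
  have habs : ∀ s : ℝ × ℝ → ℝ, Integrable s m → ∫ p, |mollify m g s p| ≤ ∫ q, |s q| ∂m :=
    fun s hs => integral_abs_mollify_le hs hgk hgc hg0 hg1
  have h3 : ∀ u v w : ℝ × ℝ → ℝ, Integrable u m → Integrable v m → Integrable w m →
      ∫ p, (|mollify m g u p| + |mollify m g v p| + |mollify m g w p|)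
        ≤ ∫ q, (|u q| + |v q| + |w q|) ∂m := by
    intro u v w hu hv hw
    have iu := (integrable_mollify hu hgk hgc).abs
    have iv := (integrable_mollify hv hgk hgc).abs
    have iw := (integrable_mollify hw hgk hgc).abs
    rw [integral_add (f := fun p => |mollify m g u p| + |mollify m g v p|) (iu.add iv) iw,
      integral_add iu iv, integral_add (f := fun p => |u p| + |v p|) (hu.abs.add hv.abs) hw.abs,
      integral_add hu.abs hv.abs]
    exact add_le_add (add_le_add (habs u hu) (habs v hv)) (habs w hw)
  have hleft : ∫ p, χ p * mollify m g (excess s₀ s₁ t₀ t₁) p ≤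
      ∫ p, χ p * min ((mollify m g s₀ p - |mollify m g s₁ p|)⁺)
        ((mollify m g t₁ p - |mollify m g t₀ p|)⁺) := by
    have hex := integrable_excess hs₀ hs₁ ht₀ ht₁
    have c := fun s (h : Integrable s m) => continuous_mollify h hgk hgc
    have c0 := c _ hs₀
    have c1 := c _ hs₁
    have c2 := c _ ht₀
    have c3 := c _ ht₁
    refine integral_mono
      ((hχ.mul (c _ hex)).integrable_of_hasCompactSupport hχc.mul_right)
      (Continuous.integrable_of_hasCompactSupport (by simp only [posPart_def]; fun_prop)
        hχc.mul_right) fun p => ?_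
    refine mul_le_mul_of_nonneg_left (le_min ?_ ?_) (hχ01 p).1
    · exact ((mollify_mono hex (hs₀.sub hs₁.abs) hgk hgc hg0
        (Eventually.of_forall fun q => min_le_left _ _) p).trans
        (mollify_sub_abs_le hs₀ hs₁ hgk hgc hg0 p)).trans (le_posPart _)
    · exact ((mollify_mono hex (ht₁.sub ht₀.abs) hgk hgc hg0
        (Eventually.of_forall fun q => min_le_right _ _) p).trans
        (mollify_sub_abs_le ht₁ ht₀ hgk hgc hg0 p)).trans (le_posPart _)
  refine hleft.trans (key.trans ?_)
  have n1 := integral_negPart_mollify_le hs₀ hs₁ hgk hgc hg0 hg1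
  have n2 := integral_negPart_mollify_le ht₁ ht₀ hgk hgc hg0 hg1
  have n3 := habs d hd
  have n4 := habs e he
  have n5 : √(∫ p, (|mollify m g s₀ p| + |mollify m g s₁ p| + |mollify m g d p|)) *
      √(∫ p, (|mollify m g t₀ p| + |mollify m g t₁ p| + |mollify m g e p|)) ≤
      √(∫ q, (|s₀ q| + |s₁ q| + |d q|) ∂m) * √(∫ q, (|t₀ q| + |t₁ q| + |e q|) ∂m) :=
    mul_le_mul (Real.sqrt_le_sqrt (h3 _ _ _ hs₀ hs₁ hd)) (Real.sqrt_le_sqrt (h3 _ _ _ ht₀ ht₁ he))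
      (Real.sqrt_nonneg _) (Real.sqrt_nonneg _)
  have n6 := mul_le_mul_of_nonneg_left n5
    (by positivity : (0 : ℝ) ≤ 18 * √(∫ p, χ p ^ 2))
  linarith

/-- The estimate with a continuous cutoff, obtained from the mollified fields in the limit. -/
theorem estimate_of_continuous [SFinite m] (hs₀ : Integrable s₀ m) (hs₁ : Integrable s₁ m)
    (hd : Integrable d m) (ht₀ : Integrable t₀ m) (ht₁ : Integrable t₁ m) (he : Integrable e m)
    (hs : 0 ≤ᵐ[m] s₀) (ht : 0 ≤ᵐ[m] t₁) (hdiv : HasDensityDiv m s₀ s₁ d)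
    (hdiv' : HasDensityDiv m t₀ t₁ e) (hχ : Continuous χ) (hχc : HasCompactSupport χ)
    (hχ01 : ∀ p, χ p ∈ Icc (0 : ℝ) 1) :
    ∫ q, excess s₀ s₁ t₀ t₁ q * χ q ∂m ≤
      18 * √(∫ p, χ p ^ 2) *
        (√(∫ q, (|s₀ q| + |s₁ q| + |d q|) ∂m) * √(∫ q, (|t₀ q| + |t₁ q| + |e q|) ∂m)) +
      ((∫ q, (s₀ q - |s₁ q|)⁻ ∂m) + (∫ q, (t₁ q - |t₀ q|)⁻ ∂m) +
      2 * (∫ q, |d q| ∂m) + 2 * ∫ q, |e q| ∂m) := by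
  set φ : ℕ → ContDiffBump (0 : ℝ × ℝ) := fun n =>
    ⟨1 / (n + 2), 1 / (n + 1), by positivity, by gcongr; norm_num⟩ with hφ
  have hφ0 : Tendsto (fun n => (φ n).rOut) atTop (𝓝 0) := tendsto_one_div_add_atTop_nhds_zero_nat
  set ρ : ℕ → ℝ × ℝ → ℝ := fun n => (φ n).normed volume with hρ
  have hex := integrable_excess hs₀ hs₁ ht₀ ht₁
  have hχb : ∀ p, |χ p| ≤ 1 := fun p => abs_le.2 ⟨by linarith [(hχ01 p).1], (hχ01 p).2⟩
  have hρc : ∀ n, Continuous (ρ n) := fun n => (φ n).continuous_normed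
  have hρs : ∀ n, HasCompactSupport (ρ n) := fun n => (φ n).hasCompactSupport_normed
  have hρ0 : ∀ n p, 0 ≤ ρ n p := fun n p => (φ n).nonneg_normed p
  have hρ1 : ∀ n, ∫ p, ρ n p = 1 := fun n => (φ n).integral_normed
  have hconv : ∀ q, Tendsto (fun n => ∫ p, χ p * ρ n (p - q)) atTop (𝓝 (χ q)) := by
    intro q
    have := ContDiffBump.convolution_tendsto_right_of_continuous (μ := volume) hφ0 hχ q
    refine this.congr fun n => ?_
    rw [convolution_eq_swap]
    refine integral_congr_ae (Eventually.of_forall fun p => ?_)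
    simp only [ContinuousLinearMap.lsmul_apply, smul_eq_mul, hρ]
    rw [← neg_sub, ContDiffBump.normed_neg, mul_comm]
  have hlim : Tendsto (fun n => ∫ q, excess s₀ s₁ t₀ t₁ q * (∫ p, χ p * ρ n (p - q)) ∂m) atTop
      (𝓝 (∫ q, excess s₀ s₁ t₀ t₁ q * χ q ∂m)) := by
    refine tendsto_integral_of_dominated_convergence (fun q => |excess s₀ s₁ t₀ t₁ q|) ?_ hex.abs
      ?_ ?_
    · intro n
      refine hex.aestronglyMeasurable.mul (Continuous.aestronglyMeasurable ?_)
      obtain ⟨B, hB⟩ := exists_bound_of_hasCompactSupport (hρc n) (hρs n)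
      have hχi : Integrable χ := hχ.integrable_of_hasCompactSupport hχc
      refine continuous_of_dominated (bound := fun p => |χ p| * B) ?_ ?_ (hχi.abs.mul_const B) ?_
      · exact fun q => Continuous.aestronglyMeasurable (by have := hρc n; fun_prop)
      · refine fun q => Eventually.of_forall fun p => ?_
        rw [Real.norm_eq_abs, abs_mul]
        exact mul_le_mul_of_nonneg_left (hB _) (abs_nonneg _)
      · exact Eventually.of_forall fun p => by have := hρc n; fun_prop
    · refine fun n => Eventually.of_forall fun q => ?_
      rw [Real.norm_eq_abs, abs_mul]
      refine mul_le_of_le_one_right (abs_nonneg _) ?_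
      have h1 : ∫ p, ρ n (p - q) = 1 := by rw [integral_sub_right_eq_self, hρ1]
      have hi : Integrable fun p => ρ n (p - q) :=
        ((hρc n).integrable_of_hasCompactSupport (hρs n)).comp_sub_right q
      rw [← h1]
      refine (abs_integral_le_integral_abs).trans (integral_mono_of_nonneg
        (Eventually.of_forall fun p => abs_nonneg _) hi (Eventually.of_forall fun p => ?_))
      simp only [abs_mul, abs_of_nonneg (hρ0 n _)]
      exact mul_le_of_le_one_left (hρ0 n _) (hχb p)
    · exact Eventually.of_forall fun q => (hconv q).const_mul _
  refine le_of_tendsto' hlim fun n => ?_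
  rw [← (integral_mul_mollify hex (hρc n) (hρs n) hχ hχb).2]
  exact estimate_mollified hs₀ hs₁ hd ht₀ ht₁ he hs ht hdiv hdiv' hχ hχc hχ01
    (φ n).contDiff_normed (hρs n) (hρ0 n) (hρ1 n)

/-- Approximation of a Borel cutoff by continuous ones, simultaneously for the Lebesgue measure and
for the measure `|w| m`. -/
theorem exists_continuous_cutoff {w : ℝ × ℝ → ℝ} (hw : Integrable w m) (hχ : Measurable χ)
    (hχ01 : ∀ p, χ p ∈ Icc (0 : ℝ) 1) (hχi : Integrable χ) {δ : ℝ} (hδ : 0 < δ) :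
    ∃ ψ : ℝ × ℝ → ℝ, Continuous ψ ∧ HasCompactSupport ψ ∧ (∀ p, ψ p ∈ Icc (0 : ℝ) 1) ∧
      ∫ p, |χ p - ψ p| ≤ δ ∧ ∫ q, |w q| * |χ q - ψ q| ∂m ≤ δ := by
  have hwm : AEMeasurable (fun q => ENNReal.ofReal |w q|) m :=
    hw.aestronglyMeasurable.aemeasurable.abs.ennreal_ofReal
  set κ : Measure (ℝ × ℝ) := m.withDensity fun q => ENNReal.ofReal |w q| with hκ
  have hκf : IsFiniteMeasure κ := isFiniteMeasure_withDensity_ofReal hw.abs.2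
  have hcpt : IsFiniteMeasureOnCompacts (volume + κ) := ⟨fun K hK => by
    rw [Measure.add_apply]
    exact ENNReal.add_lt_top.2 ⟨hK.measure_lt_top, hK.measure_lt_top⟩⟩
  have hlf : IsLocallyFiniteMeasure (volume + κ) :=
    isLocallyFiniteMeasure_of_isFiniteMeasureOnCompacts
  have hχb : ∀ p, ‖χ p‖ ≤ 1 := fun p =>
    abs_le.2 ⟨by linarith [(hχ01 p).1], (hχ01 p).2⟩
  have hχκ : Integrable χ κ := Integrable.of_bound hχ.aestronglyMeasurable 1
    (Eventually.of_forall hχb)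
  obtain ⟨g, hgc, hgδ, hg, hgi⟩ :=
    (hχi.add_measure hχκ).exists_hasCompactSupport_integral_sub_le hδ
  set ψ : ℝ × ℝ → ℝ := fun p => max 0 (min 1 (g p)) with hψ
  have hψc : Continuous ψ := by fun_prop
  have hψs : HasCompactSupport ψ :=
    hgc.comp_left (g := fun t : ℝ => max 0 (min 1 t)) (by simp)
  have hψ01 : ∀ p, ψ p ∈ Icc (0 : ℝ) 1 := fun p =>
    ⟨le_max_left _ _, max_le zero_le_one (min_le_left _ _)⟩
  have hcl : ∀ p, |χ p - ψ p| ≤ ‖χ p - g p‖ := by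
    intro p
    have h1 := abs_clamp_sub_clamp_le 0 1 (χ p) (g p)
    rwa [min_eq_right (hχ01 p).2, max_eq_right (hχ01 p).1] at h1
  have hm1 : Measurable fun p => |χ p - ψ p| := (hχ.sub hψc.measurable).abs
  have hgv : Integrable (fun p => ‖χ p - g p‖) (volume + κ) :=
    ((hχi.add_measure hχκ).sub hgi).norm
  have hψi : Integrable (fun p => |χ p - ψ p|) (volume + κ) :=
    hgv.mono' hm1.aestronglyMeasurable (Eventually.of_forall fun p => by
      rw [Real.norm_eq_abs, abs_abs]; exact hcl p)
  have htot : ∫ p, |χ p - ψ p| ∂(volume + κ) ≤ δ :=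
    (integral_mono hψi hgv hcl).trans hgδ
  have hv := hψi.left_of_add_measure
  have hk := hψi.right_of_add_measure
  rw [integral_add_measure hv hk] at htot
  have n1 : 0 ≤ ∫ p, |χ p - ψ p| := integral_nonneg fun p => abs_nonneg _
  have n2 : 0 ≤ ∫ p, |χ p - ψ p| ∂κ := integral_nonneg fun p => abs_nonneg _
  refine ⟨ψ, hψc, hψs, hψ01, by linarith, ?_⟩
  have : ∫ p, |χ p - ψ p| ∂κ = ∫ q, |w q| * |χ q - ψ q| ∂m := by
    rw [hκ, integral_withDensity_eq_integral_toReal_smul₀ hwm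
      (Eventually.of_forall fun q => ENNReal.ofReal_lt_top)]
    simp only [ENNReal.toReal_ofReal (abs_nonneg _), smul_eq_mul]
  linarith

/-- The estimate for measures on `ℝ × ℝ` given by densities with respect to a common reference
measure `m`. -/
theorem density_estimate [SFinite m] (hs₀ : Integrable s₀ m) (hs₁ : Integrable s₁ m)
    (hd : Integrable d m) (ht₀ : Integrable t₀ m) (ht₁ : Integrable t₁ m) (he : Integrable e m)
    (hs : 0 ≤ᵐ[m] s₀) (ht : 0 ≤ᵐ[m] t₁) (hdiv : HasDensityDiv m s₀ s₁ d)
    (hdiv' : HasDensityDiv m t₀ t₁ e) (hχ : Measurable χ) (hχ01 : ∀ p, χ p ∈ Icc (0 : ℝ) 1)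
    (hχi : Integrable χ) :
    ∫ q, χ q * min ((s₀ q - |s₁ q|)⁺) ((t₁ q - |t₀ q|)⁺) ∂m ≤
      18 * √(∫ p, χ p ^ 2) *
        (√(∫ q, (|s₀ q| + |s₁ q| + |d q|) ∂m) * √(∫ q, (|t₀ q| + |t₁ q| + |e q|) ∂m)) +
      ((∫ q, (s₀ q - |s₁ q|)⁻ ∂m) + (∫ q, (t₁ q - |t₀ q|)⁻ ∂m) +
      2 * (∫ q, |d q| ∂m) + 2 * ∫ q, |e q| ∂m) := by
  set w := excess s₀ s₁ t₀ t₁ with hw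
  have hwi : Integrable w m := integrable_excess hs₀ hs₁ ht₀ ht₁
  have hpos : ∀ q, min ((s₀ q - |s₁ q|)⁺) ((t₁ q - |t₀ q|)⁺) = (w q)⁺ := fun q =>
    (posPart_min _ _).symm
  simp only [hpos]
  -- the cutoff is restricted to the set where the density is positive
  set w' := hwi.aestronglyMeasurable.mk w with hw'
  have hww' : w =ᵐ[m] w' := hwi.aestronglyMeasurable.ae_eq_mk
  set A : Set (ℝ × ℝ) := {q | 0 < w' q} with hA
  have hAm : MeasurableSet A :=
    measurableSet_lt measurable_const hwi.aestronglyMeasurable.stronglyMeasurable_mk.measurable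
  set η : ℝ × ℝ → ℝ := A.indicator χ with hη
  have hηm : Measurable η := hχ.indicator hAm
  have hη01 : ∀ p, η p ∈ Icc (0 : ℝ) 1 := fun p => by
    by_cases hp : p ∈ A
    · rw [hη, indicator_of_mem hp]; exact hχ01 p
    · rw [hη, indicator_of_notMem hp]; simp
  have hηle : ∀ p, η p ≤ χ p := fun p => indicator_le_self' (fun q _ => (hχ01 q).1) p
  have hηi : Integrable η := hχi.indicator hAm
  have hleft : ∫ q, χ q * (w q)⁺ ∂m = ∫ q, w q * η q ∂m := by
    refine integral_congr_ae ?_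
    filter_upwards [hww'] with q hq
    by_cases hqA : q ∈ A
    · have : 0 < w q := by rw [hq]; exact hqA
      rw [hη, indicator_of_mem hqA, posPart_of_nonneg this.le, mul_comm]
    · have : w q ≤ 0 := by rw [hq]; exact not_lt.1 hqA
      rw [hη, indicator_of_notMem hqA, posPart_of_nonpos this, mul_zero, mul_zero]
  rw [hleft]
  set K := √(∫ q, (|s₀ q| + |s₁ q| + |d q|) ∂m) * √(∫ q, (|t₀ q| + |t₁ q| + |e q|) ∂m) with hK
  set N := (∫ q, (s₀ q - |s₁ q|)⁻ ∂m) + (∫ q, (t₁ q - |t₀ q|)⁻ ∂m) +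
      2 * (∫ q, |d q| ∂m) + 2 * ∫ q, |e q| ∂m with hN
  have hK0 : 0 ≤ K := by positivity
  have hχ2 : Integrable fun p => χ p ^ 2 := by
    refine hχi.mono' (hχ.pow_const 2).aestronglyMeasurable (Eventually.of_forall fun p => ?_)
    rw [Real.norm_eq_abs, abs_of_nonneg (sq_nonneg _), sq]
    exact mul_le_of_le_one_left (hχ01 p).1 (hχ01 p).2
  have hbound : ∀ δ : ℝ, 0 < δ →
      ∫ q, w q * η q ∂m ≤ 18 * √((∫ p, χ p ^ 2) + 2 * δ) * K + N + δ := by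
    intro δ hδ
    obtain ⟨ψ, hψ, hψc, hψ01, hψ1, hψ2⟩ := exists_continuous_cutoff hwi hηm hη01 hηi hδ
    have h1 := estimate_of_continuous hs₀ hs₁ hd ht₀ ht₁ he hs ht hdiv hdiv' hψ hψc hψ01
    have hψi : Integrable ψ := hψ.integrable_of_hasCompactSupport hψc
    have hb : ∀ u : ℝ × ℝ → ℝ, Measurable u → (∀ p, u p ∈ Icc (0 : ℝ) 1) →
        Integrable (fun q => w q * u q) m := fun u hu hu01 =>
      hwi.mul_bdd (c := 1) hu.aestronglyMeasurable (Eventually.of_forall fun q =>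
        abs_le.2 ⟨by linarith [(hu01 q).1], (hu01 q).2⟩)
    have hbη := hb η hηm hη01
    have hbψ := hb ψ hψ.measurable hψ01
    have h2 : ∫ q, w q * η q ∂m ≤ (∫ q, w q * ψ q ∂m) + δ := by
      have : (∫ q, w q * η q ∂m) - ∫ q, w q * ψ q ∂m ≤ ∫ q, |w q| * |η q - ψ q| ∂m := by
        rw [← integral_sub hbη hbψ]
        refine (le_abs_self _).trans ((abs_integral_le_integral_abs).trans (le_of_eq ?_))
        refine integral_congr_ae (Eventually.of_forall fun q => ?_)
        simp only [← mul_sub, abs_mul]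
      linarith
    have h3 : ∫ p, ψ p ^ 2 ≤ (∫ p, χ p ^ 2) + 2 * δ := by
      have hd1 : Integrable fun p => |η p - ψ p| := (hηi.sub hψi).abs
      have : ∫ p, ψ p ^ 2 ≤ ∫ p, (χ p ^ 2 + 2 * |η p - ψ p|) := by
        refine integral_mono_of_nonneg (Eventually.of_forall fun p => sq_nonneg _)
          (hχ2.add (hd1.const_mul 2)) (Eventually.of_forall fun p => ?_)
        have e1 := hη01 p
        have e2 := hψ01 p
        have e3 : η p ^ 2 ≤ χ p ^ 2 := pow_le_pow_left₀ e1.1 (hηle p) 2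
        have e4 : ψ p - η p ≤ |η p - ψ p| := by rw [abs_sub_comm]; exact le_abs_self _
        have e5 : (ψ p + η p) * (ψ p - η p) ≤ 2 * |η p - ψ p| := by
          refine (mul_le_mul_of_nonneg_left e4 (add_nonneg e2.1 e1.1)).trans
            (mul_le_mul_of_nonneg_right (by linarith [e1.2, e2.2]) (abs_nonneg _))
        simp only
        nlinarith
      rw [integral_add hχ2 (hd1.const_mul 2), integral_const_mul] at this
      linarith
    have h4 : 18 * √(∫ p, ψ p ^ 2) * K ≤ 18 * √((∫ p, χ p ^ 2) + 2 * δ) * K := by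
      gcongr
    linarith
  have hlim : Tendsto (fun δ : ℝ => 18 * √((∫ p, χ p ^ 2) + 2 * δ) * K + N + δ) (𝓝[>] 0)
      (𝓝 (18 * √((∫ p, χ p ^ 2) + 2 * 0) * K + N + 0)) :=
    Tendsto.mono_left (Continuous.tendsto (by fun_prop) 0) nhdsWithin_le_nhds
  have := ge_of_tendsto hlim (by
    filter_upwards [self_mem_nhdsWithin] with δ hδ using hbound δ hδ)
  simpa using this

/-! ### Signed measures with a density -/

section SignedDensity

variable {m : Measure Plane} {f : Plane → ℝ}

theorem toJordanDecomposition_withDensityᵥ (hf : Integrable f m) (hfm : Measurable f) :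
    (SignedMeasure.toJordanDecomposition (m.withDensityᵥ f)).posPart =
      m.withDensity (fun x => ENNReal.ofReal (f x)) ∧
    (SignedMeasure.toJordanDecomposition (m.withDensityᵥ f)).negPart =
      m.withDensity (fun x => ENNReal.ofReal (-f x)) := by
  have h1 := isFiniteMeasure_withDensity_ofReal hf.2
  have h2 := isFiniteMeasure_withDensity_ofReal hf.neg.2
  set j : JordanDecomposition Plane :=
    { posPart := m.withDensity fun x => ENNReal.ofReal (f x)
      negPart := m.withDensity fun x => ENNReal.ofReal (-f x)
      posPart_finite := h1
      negPart_finite := h2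
      mutuallySingular := withDensity_ofReal_mutuallySingular hfm } with hj
  have : SignedMeasure.toJordanDecomposition (m.withDensityᵥ f) = j :=
    SignedMeasure.toJordanDecomposition_eq (s := m.withDensityᵥ f) (j := j)
      (withDensityᵥ_eq_withDensity_pos_part_sub_withDensity_neg_part hf)
  rw [this]
  exact ⟨rfl, rfl⟩

theorem measureReal_withDensity_ofReal (hf : Integrable f m) {s : Set Plane}
    (hs : MeasurableSet s) :
    (m.withDensity fun x => ENNReal.ofReal (f x)).real s = ∫ x in s, (f x)⁺ ∂m := by
  rw [measureReal_def, withDensity_apply _ hs, ← integral_toReal]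
  · refine integral_congr_ae (Eventually.of_forall fun x => ?_)
    simp only [ENNReal.toReal_ofReal', posPart_def]
  · exact hf.aestronglyMeasurable.aemeasurable.ennreal_ofReal.restrict
  · exact Eventually.of_forall fun x => ENNReal.ofReal_lt_top

theorem posMeas_withDensityᵥ (hf : Integrable f m) (hfm : Measurable f) :
    posMeas (m.withDensityᵥ f) = m.withDensityᵥ fun x => (f x)⁺ := by
  ext s hs
  rw [posMeas, Measure.toSignedMeasure_apply_measurable hs,
    (toJordanDecomposition_withDensityᵥ hf hfm).1, measureReal_withDensity_ofReal hf hs,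
    withDensityᵥ_apply (f := fun x => (f x)⁺) hf.pos_part hs]

theorem negMeas_withDensityᵥ (hf : Integrable f m) (hfm : Measurable f) :
    negMeas (m.withDensityᵥ f) = m.withDensityᵥ fun x => (f x)⁻ := by
  ext s hs
  rw [negMeas, Measure.toSignedMeasure_apply_measurable hs,
    (toJordanDecomposition_withDensityᵥ hf hfm).2,
    measureReal_withDensity_ofReal (f := fun x => -f x) hf.neg hs,
    withDensityᵥ_apply (f := fun x => (f x)⁻) hf.neg_part hs]
  simp only [posPart_neg]

theorem totalVariation_real_withDensityᵥ (hf : Integrable f m) (hfm : Measurable f) {s : Set Plane}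
    (hs : MeasurableSet s) :
    (SignedMeasure.totalVariation (m.withDensityᵥ f)).real s = ∫ x in s, |f x| ∂m := by
  rw [SignedMeasure.totalVariation, measureReal_add_apply,
    (toJordanDecomposition_withDensityᵥ hf hfm).1, (toJordanDecomposition_withDensityᵥ hf hfm).2,
    measureReal_withDensity_ofReal hf hs,
    measureReal_withDensity_ofReal (f := fun x => -f x) hf.neg hs]
  simp only [posPart_neg]
  rw [← integral_add (f := fun x => (f x)⁺) (g := fun x => (f x)⁻)
    (Integrable.integrableOn hf.pos_part) (Integrable.integrableOn hf.neg_part)]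
  exact integral_congr_ae (Eventually.of_forall fun x => posPart_add_negPart (f x))

theorem absMeas_withDensityᵥ (hf : Integrable f m) (hfm : Measurable f) :
    absMeas (m.withDensityᵥ f) = m.withDensityᵥ fun x => |f x| := by
  ext s hs
  rw [absMeas, Measure.toSignedMeasure_apply_measurable hs,
    totalVariation_real_withDensityᵥ hf hfm hs, withDensityᵥ_apply hf.abs hs]

theorem minMeas_withDensityᵥ {g : Plane → ℝ} (hf : Integrable f m) (hfm : Measurable f)
    (hg : Integrable g m) (hgm : Measurable g) :
    minMeas (m.withDensityᵥ f) (m.withDensityᵥ g) = m.withDensityᵥ fun x => min (f x) (g x) := by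
  have hfg : Integrable (fun x => |f x - g x|) m := (hf.sub hg).abs
  have h1 : m.withDensityᵥ f - m.withDensityᵥ g = m.withDensityᵥ fun x => f x - g x :=
    (withDensityᵥ_sub hf hg).symm
  rw [minMeas, h1, absMeas_withDensityᵥ (f := fun x => f x - g x) (hf.sub hg) (hfm.sub hgm),
    ← withDensityᵥ_add hf hg, ← withDensityᵥ_sub (hf.add hg) hfg, ← withDensityᵥ_smul]
  congr 1
  funext x
  simp only [Pi.smul_apply, Pi.sub_apply, Pi.add_apply, smul_eq_mul]
  rcases le_total (f x) (g x) with h | h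
  · rw [min_eq_left h, abs_of_nonpos (sub_nonpos.2 h)]
    ring
  · rw [min_eq_right h, abs_of_nonneg (sub_nonneg.2 h)]
    ring

theorem integral_withDensityᵥ (hf : Integrable f m) {φ : Plane → ℝ} (hφ : Measurable φ) {B : ℝ}
    (hB : ∀ p, |φ p| ≤ B) :
    ∫ᵛ p, φ p ∂<•(m.withDensityᵥ f) = ∫ p, φ p * f p ∂m := by
  have h1 := isFiniteMeasure_withDensity_ofReal hf.2
  have h2 : IsFiniteMeasure (m.withDensity fun x => ENNReal.ofReal (-f x)) :=
    isFiniteMeasure_withDensity_ofReal hf.neg.2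
  have hφi : ∀ (μ : Measure Plane) [IsFiniteMeasure μ], Integrable φ μ := fun μ _ =>
    Integrable.of_bound hφ.aestronglyMeasurable B (Eventually.of_forall hB)
  have hw : ∀ u : Plane → ℝ, Integrable u m →
      ∫ p, φ p ∂(m.withDensity fun x => ENNReal.ofReal (u x)) = ∫ p, (u p)⁺ * φ p ∂m := by
    intro u hu
    rw [integral_withDensity_eq_integral_toReal_smul₀
      hu.aestronglyMeasurable.aemeasurable.ennreal_ofReal
      (Eventually.of_forall fun q => ENNReal.ofReal_lt_top)]
    simp only [ENNReal.toReal_ofReal', smul_eq_mul, posPart_def]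
  rw [withDensityᵥ_eq_withDensity_pos_part_sub_withDensity_neg_part hf,
    VectorMeasure.integral_sub_vectorMeasure, VectorMeasure.integral_toSignedMeasure,
    VectorMeasure.integral_toSignedMeasure, hw f hf, hw (fun x => -f x) hf.neg]
  · simp only [posPart_neg]
    rw [← integral_sub]
    · refine integral_congr_ae (Eventually.of_forall fun p => ?_)
      simp only [← sub_mul, posPart_sub_negPart]
      exact mul_comm _ _
    · exact hf.pos_part.mul_bdd (c := B) hφ.aestronglyMeasurable (Eventually.of_forall hB)
    · exact hf.neg_part.mul_bdd (c := B) hφ.aestronglyMeasurable (Eventually.of_forall hB)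
  · rw [VectorMeasure.Integrable, Measure.variation_toSignedMeasure]; exact hφi _
  · rw [VectorMeasure.Integrable, Measure.variation_toSignedMeasure]; exact hφi _

theorem ae_nonneg_of_withDensityᵥ_nonneg (hf : Integrable f m) (h : 0 ≤ m.withDensityᵥ f) :
    0 ≤ᵐ[m] f := by
  refine ae_nonneg_of_forall_setIntegral_nonneg hf fun s hs _ => ?_
  have := h s hs
  rwa [withDensityᵥ_apply hf hs] at this

/-- The Radon-Nikodym theorem for a signed measure dominated by `m`. -/
theorem exists_density [SigmaFinite m] {ν : SignedMeasure Plane} (h : ν.totalVariation ≤ m) :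
    ∃ f : Plane → ℝ, Measurable f ∧ Integrable f m ∧ ν = m.withDensityᵥ f := by
  refine ⟨ν.rnDeriv m, SignedMeasure.measurable_rnDeriv _ _, SignedMeasure.integrable_rnDeriv _ _,
    (SignedMeasure.withDensityᵥ_rnDeriv_eq ν m ?_).symm⟩
  rw [SignedMeasure.absolutelyContinuous_ennreal_iff]
  have : m.toENNRealVectorMeasure.ennrealToMeasure = m := VectorMeasure.equivMeasure.right_inv m
  rw [this]
  exact Measure.absolutelyContinuous_of_le h

end SignedDensity

/-! ### Passage from `ℝ × ℝ` to the Euclidean plane -/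

/-- The coordinates `p ↦ (p 0, p 1)` on the plane, as a linear homeomorphism. -/
def planeEquiv : Plane ≃L[ℝ] ℝ × ℝ :=
  (EuclideanSpace.equiv (Fin 2) ℝ).trans (ContinuousLinearEquiv.finTwoArrow ℝ ℝ)

theorem measurePreserving_planeEquiv : MeasurePreserving planeEquiv :=
  (volume_preserving_finTwoArrow ℝ).comp (PiLp.volume_preserving_ofLp (Fin 2))

theorem measurableEmbedding_planeEquiv : MeasurableEmbedding planeEquiv :=
  planeEquiv.toHomeomorph.measurableEmbedding

theorem partialDeriv_comp_planeEquiv {φ : ℝ × ℝ → ℝ} (p : Plane) :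
    partialDeriv 0 (φ ∘ planeEquiv) p = px φ (planeEquiv p) ∧
      partialDeriv 1 (φ ∘ planeEquiv) p = py φ (planeEquiv p) := by
  have h0 : planeEquiv (EuclideanSpace.single 0 1) = (1, 0) := by
    simp [planeEquiv]
  have h1 : planeEquiv (EuclideanSpace.single 1 1) = (0, 1) := by
    simp [planeEquiv]
  constructor
  · rw [partialDeriv, px, planeEquiv.comp_right_fderiv, ← h0]
    rfl
  · rw [partialDeriv, py, planeEquiv.comp_right_fderiv, ← h1]
    rfl

theorem sqrt_integral_sq_eq_eLpNorm {χ : Plane → ℝ} (hχ : MemLp χ 2) :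
    √(∫ p, χ p ^ 2) = (eLpNorm χ 2 volume).toReal := by
  rw [hχ.eLpNorm_eq_integral_rpow_norm two_ne_zero ENNReal.ofNat_ne_top, ENNReal.toReal_ofReal,
    Real.sqrt_eq_rpow]
  · simp
  · positivity

theorem memLp_of_bounded_support {χ : Plane → ℝ} (hχ : Measurable χ)
    (hχ01 : ∀ p, χ p ∈ Icc (0 : ℝ) 1) (hb : Bornology.IsBounded (Function.support χ))
    (r : ENNReal) : MemLp χ r := by
  obtain ⟨R, hR⟩ := hb.subset_closedBall 0
  have h : MemLp ((Metric.closedBall (0 : Plane) R).indicator χ) r := by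
    rw [memLp_indicator_iff_restrict Metric.isClosed_closedBall.measurableSet]
    have : IsFiniteMeasure (volume.restrict (Metric.closedBall (0 : Plane) R)) :=
      isFiniteMeasure_restrict.2 (isCompact_closedBall 0 R).measure_ne_top
    refine MemLp.of_bound hχ.aestronglyMeasurable 1 (Eventually.of_forall fun p => ?_)
    rw [Real.norm_eq_abs, abs_of_nonneg (hχ01 p).1]
    exact (hχ01 p).2
  rwa [indicator_eq_self.2 hR] at h

/-- The estimate for a pair of fields on the plane which are given by densities with respect to a
common measure `μ`. The masses are compared with `2 A` and `2 B` because `|v^x| + |v^y| ≤ 2 |v|`.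
Both Sobolev fields (with `μ` the Lebesgue measure) and vector measures
(with `μ` the sum of all the total variations) are of this form. -/
theorem plane_density_estimate {μ : Measure Plane} [SFinite μ] {s₀ s₁ d t₀ t₁ e χ : Plane → ℝ}
    (hs₀ : Integrable s₀ μ) (hs₁ : Integrable s₁ μ) (hd : Integrable d μ)
    (ht₀ : Integrable t₀ μ) (ht₁ : Integrable t₁ μ) (he : Integrable e μ)
    (hs : 0 ≤ᵐ[μ] s₀) (ht : 0 ≤ᵐ[μ] t₁)
    (hdiv : ∀ φ, IsTestFunction φ → (∫ p, partialDeriv 0 φ p * s₀ p ∂μ) +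
      (∫ p, partialDeriv 1 φ p * s₁ p ∂μ) = - ∫ p, φ p * d p ∂μ)
    (hdiv' : ∀ φ, IsTestFunction φ → (∫ p, partialDeriv 0 φ p * t₀ p ∂μ) +
      (∫ p, partialDeriv 1 φ p * t₁ p ∂μ) = - ∫ p, φ p * e p ∂μ)
    (hχ : Measurable χ) (hχ01 : ∀ p, χ p ∈ Icc (0 : ℝ) 1)
    (hb : Bornology.IsBounded (Function.support χ)) {A B : ℝ}
    (hA : ∫ p, (|s₀ p| + |s₁ p| + |d p|) ∂μ ≤ 2 * A)
    (hB : ∫ p, (|t₀ p| + |t₁ p| + |e p|) ∂μ ≤ 2 * B) :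
    ∫ p, χ p * min ((s₀ p - |s₁ p|)⁺) ((t₁ p - |t₀ p|)⁺) ∂μ ≤
      36 * (eLpNorm χ 2 volume).toReal * √A * √B +
        ((∫ p, (s₀ p - |s₁ p|)⁻ ∂μ) + (∫ p, (t₁ p - |t₀ p|)⁻ ∂μ) +
          36 * (∫ p, |d p| ∂μ) + 36 * ∫ p, |e p| ∂μ) := by
  have hemb := measurableEmbedding_planeEquiv
  have hm : Measurable planeEquiv.symm := planeEquiv.symm.continuous.measurable
  have hint : ∀ {f : Plane → ℝ}, Integrable f μ →
      Integrable (fun q => f (planeEquiv.symm q)) (μ.map planeEquiv) := by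
    intro f hf
    rw [hemb.integrable_map_iff]
    simpa [Function.comp_def] using hf
  have hival : ∀ F : ℝ × ℝ → ℝ, ∫ q, F q ∂(μ.map planeEquiv) = ∫ p, F (planeEquiv p) ∂μ :=
    hemb.integral_map
  have hae : ∀ {f : Plane → ℝ}, 0 ≤ᵐ[μ] f →
      0 ≤ᵐ[μ.map planeEquiv] fun q => f (planeEquiv.symm q) := by
    intro f hf
    rw [EventuallyLE, hemb.ae_map_iff]
    simp only [ContinuousLinearEquiv.symm_apply_apply]
    exact hf
  have hd' : ∀ {s₀ s₁ d : Plane → ℝ}, (∀ φ, IsTestFunction φ →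
      (∫ p, partialDeriv 0 φ p * s₀ p ∂μ) + (∫ p, partialDeriv 1 φ p * s₁ p ∂μ)
        = - ∫ p, φ p * d p ∂μ) →
      HasDensityDiv (μ.map planeEquiv) (fun q => s₀ (planeEquiv.symm q))
        (fun q => s₁ (planeEquiv.symm q)) (fun q => d (planeEquiv.symm q)) := by
    intro s₀ s₁ d h φ hφ hφc
    have := h (φ ∘ planeEquiv) ⟨hφ.comp planeEquiv.contDiff,
      hφc.comp_homeomorph planeEquiv.toHomeomorph⟩
    simp only [hival, ContinuousLinearEquiv.symm_apply_apply]
    simpa only [(partialDeriv_comp_planeEquiv _).1, (partialDeriv_comp_planeEquiv _).2,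
      Function.comp_apply] using this
  have hvol : ∀ F : ℝ × ℝ → ℝ, ∫ q, F q = ∫ p, F (planeEquiv p) := fun F =>
    (measurePreserving_planeEquiv.integral_comp hemb F).symm
  have hχi : Integrable fun q => χ (planeEquiv.symm q) := by
    rw [← measurePreserving_planeEquiv.integrable_comp_emb hemb]
    simpa [Function.comp_def] using
      memLp_one_iff_integrable.1 (memLp_of_bounded_support hχ hχ01 hb 1)
  have key := density_estimate (hint hs₀) (hint hs₁) (hint hd) (hint ht₀) (hint ht₁) (hint he)
    (hae hs) (hae ht) (hd' hdiv) (hd' hdiv') (hχ.comp hm) (fun q => hχ01 _) hχi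
  simp only [hival, hvol, ContinuousLinearEquiv.symm_apply_apply, Function.comp_apply] at key
  rw [sqrt_integral_sq_eq_eLpNorm (memLp_of_bounded_support hχ hχ01 hb 2)] at key
  refine key.trans ?_
  have hsqrt : √(∫ p, (|s₀ p| + |s₁ p| + |d p|) ∂μ) * √(∫ p, (|t₀ p| + |t₁ p| + |e p|) ∂μ)
      ≤ 2 * (√A * √B) :=
    calc _ ≤ √(2 * A) * √(2 * B) := by gcongr
      _ = (√2 * √2) * (√A * √B) := by
        rw [Real.sqrt_mul zero_le_two, Real.sqrt_mul zero_le_two]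
        ring
      _ = _ := by rw [Real.mul_self_sqrt zero_le_two]
  have h0 : (0 : ℝ) ≤ 18 * (eLpNorm χ 2 volume).toReal := by positivity
  have h1 := mul_le_mul_of_nonneg_left hsqrt h0
  have h2 : 0 ≤ ∫ p, |d p| ∂μ := integral_nonneg fun p => abs_nonneg _
  have h3 : 0 ≤ ∫ p, |e p| ∂μ := integral_nonneg fun p => abs_nonneg _
  nlinarith

/-! ### Sobolev fields -/

theorem weakPartial_ae_eq {i : Fin 2} {u v : Plane → ℝ} (h : HasWeakPartial i u v) :
    weakPartial i u =ᵐ[volume] v := by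
  have hex : ∃ v, HasWeakPartial i u v := ⟨v, h⟩
  have hw : HasWeakPartial i u (weakPartial i u) := by
    rw [weakPartial, dif_pos hex]
    exact hex.choose_spec
  refine ae_eq_of_integral_contDiff_smul_eq hw.locallyIntegrable_right h.locallyIntegrable_right
    fun φ hφ hφc => ?_
  have h1 := hw.integral_eq φ ⟨hφ, hφc⟩
  have h2 := h.integral_eq φ ⟨hφ, hφc⟩
  simp only [smul_eq_mul, mul_comm (φ _)]
  linarith

theorem MemW11.integrable_weakPartial {S : Plane → Plane} (hS : MemW11 S) (i j : Fin 2) :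
    Integrable (weakPartial i fun p => S p j) ∧
      HasWeakPartial i (fun p => S p j) (weakPartial i fun p => S p j) := by
  obtain ⟨v, hv, hw⟩ := hS.2 i j
  have hex : ∃ v, HasWeakPartial i (fun p => S p j) v := ⟨v, hw⟩
  refine ⟨hv.congr (weakPartial_ae_eq hw).symm, ?_⟩
  rw [weakPartial, dif_pos hex]
  exact hex.choose_spec

theorem MemW11.integrable_component {S : Plane → Plane} (hS : MemW11 S) (i : Fin 2) :
    Integrable fun p => S p i :=
  (EuclideanSpace.proj i : Plane →L[ℝ] ℝ).integrable_comp hS.1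

theorem MemW11.integrable_weakDiv {S : Plane → Plane} (hS : MemW11 S) : Integrable (weakDiv S) :=
  (hS.integrable_weakPartial 0 0).1.add (hS.integrable_weakPartial 1 1).1

theorem IsTestFunction.exists_bound {φ : Plane → ℝ} (hφ : IsTestFunction φ) :
    ∃ B, ∀ p, |φ p| ≤ B :=
  hφ.2.exists_bound_of_continuous hφ.1.continuous

theorem IsTestFunction.continuous_partialDeriv {φ : Plane → ℝ} (hφ : IsTestFunction φ)
    (i : Fin 2) : Continuous (partialDeriv i φ) :=
  (hφ.1.continuous_fderiv (by simp)).clm_apply continuous_const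

theorem IsTestFunction.exists_bound_partialDeriv {φ : Plane → ℝ} (hφ : IsTestFunction φ)
    (i : Fin 2) : ∃ B, ∀ p, |partialDeriv i φ p| ≤ B := by
  have hc : HasCompactSupport (partialDeriv i φ) :=
    (hφ.2.fderiv ℝ).comp_left (g := fun L : Plane →L[ℝ] ℝ => L (EuclideanSpace.single i 1)) rfl
  exact hc.exists_bound_of_continuous (hφ.continuous_partialDeriv i)

theorem MemW11.integral_weakDiv {S : Plane → Plane} (hS : MemW11 S) {φ : Plane → ℝ}
    (hφ : IsTestFunction φ) :
    (∫ p, partialDeriv 0 φ p * S p 0) + (∫ p, partialDeriv 1 φ p * S p 1)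
      = - ∫ p, φ p * weakDiv S p := by
  obtain ⟨B, hB⟩ := hφ.exists_bound
  have h0 := hS.integrable_weakPartial 0 0
  have h1 := hS.integrable_weakPartial 1 1
  have e0 := h0.2.integral_eq φ hφ
  have e1 := h1.2.integral_eq φ hφ
  have hsum : ∫ p, weakDiv S p * φ p = (∫ p, weakPartial 0 (fun q => S q 0) p * φ p) +
      ∫ p, weakPartial 1 (fun q => S q 1) p * φ p := by
    simp only [weakDiv, add_mul]
    exact integral_add
      (h0.1.mul_bdd (c := B) hφ.1.continuous.aestronglyMeasurable (Eventually.of_forall hB))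
      (h1.1.mul_bdd (c := B) hφ.1.continuous.aestronglyMeasurable (Eventually.of_forall hB))
  simp only [mul_comm (φ _), mul_comm (partialDeriv _ _ _)]
  linarith

theorem MemW11.integral_abs_le {S : Plane → Plane} (hS : MemW11 S) :
    ∫ p, (|S p 0| + |S p 1| + |weakDiv S p|) ≤ 2 * ∫ p, (‖S p‖ + |weakDiv S p|) := by
  rw [← integral_const_mul]
  refine integral_mono (((hS.integrable_component 0).abs.add (hS.integrable_component 1).abs).add
    hS.integrable_weakDiv.abs) ((hS.1.norm.add hS.integrable_weakDiv.abs).const_mul 2) fun p => ?_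
  have h0 : |S p 0| ≤ ‖S p‖ := PiLp.norm_apply_le (S p) 0
  have h1 : |S p 1| ≤ ‖S p‖ := PiLp.norm_apply_le (S p) 1
  have h2 := abs_nonneg (weakDiv S p)
  simp only
  linarith

theorem sobolev_estimate {S T : Plane → Plane} {χ : Plane → ℝ} (hS : MemW11 S) (hT : MemW11 T)
    (hS0 : ∀ᵐ p, 0 ≤ S p 0) (hT1 : ∀ᵐ p, 0 ≤ T p 1) (hχ : Measurable χ)
    (hχ01 : ∀ p, χ p ∈ Icc (0 : ℝ) 1) (hb : Bornology.IsBounded (Function.support χ)) :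
    ∫ p, χ p * min ((S p 0 - |S p 1|)⁺) ((T p 1 - |T p 0|)⁺) ≤
      36 * (eLpNorm χ 2 volume).toReal * √(∫ p, (‖S p‖ + |weakDiv S p|))
          * √(∫ p, (‖T p‖ + |weakDiv T p|)) +
        ∫ p, (36 * |weakDiv S p| + 36 * |weakDiv T p| + (S p 0 - |S p 1|)⁻
          + (T p 1 - |T p 0|)⁻) := by
  have hi := hS.integrable_component
  have hj := hT.integrable_component
  have hd := hS.integrable_weakDiv
  have he := hT.integrable_weakDiv
  have hN : Integrable fun p => (S p 0 - |S p 1|)⁻ := ((hi 0).sub (hi 1).abs).neg_part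
  have hN' : Integrable fun p => (T p 1 - |T p 0|)⁻ := ((hj 1).sub (hj 0).abs).neg_part
  have hd' : Integrable fun p => 36 * |weakDiv S p| := hd.abs.const_mul 36
  have he' : Integrable fun p => 36 * |weakDiv T p| := he.abs.const_mul 36
  refine (plane_density_estimate (hi 0) (hi 1) hd (hj 0) (hj 1) he hS0 hT1
    (fun φ hφ => hS.integral_weakDiv hφ) (fun φ hφ => hT.integral_weakDiv hφ) hχ hχ01 hb
    hS.integral_abs_le hT.integral_abs_le).trans (le_of_eq ?_)
  have h2 : Integrable fun p => 36 * |weakDiv S p| + 36 * |weakDiv T p| := hd'.add he'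
  have h3 : Integrable fun p => 36 * |weakDiv S p| + 36 * |weakDiv T p| + (S p 0 - |S p 1|)⁻ :=
    h2.add hN
  rw [integral_add h3 hN', integral_add h2 hN, integral_add hd' he', integral_const_mul,
    integral_const_mul]
  ring

/-! ### Vector measures -/

theorem totalVariation_comp_le (S : VectorMeasure Plane Plane) (i : Fin 2) :
    (comp S i).totalVariation ≤ S.variation := by
  rw [SignedMeasure.totalVariation_eq_variation]
  refine VectorMeasure.variation_le_of_forall_enorm_le fun s _ => ?_
  refine le_trans ?_ (VectorMeasure.enorm_measure_le_variation S s)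
  exact enorm_le_iff_norm_le.2 (PiLp.norm_apply_le (S s) i)

theorem hasDivergence_withDensityᵥ {m : Measure Plane} {S : VectorMeasure Plane Plane}
    {δ : SignedMeasure Plane} (h : HasDivergence S δ) {s₀ s₁ d : Plane → ℝ}
    (hs₀ : Integrable s₀ m) (hs₁ : Integrable s₁ m) (hd : Integrable d m)
    (e₀ : comp S 0 = m.withDensityᵥ s₀) (e₁ : comp S 1 = m.withDensityᵥ s₁)
    (ed : δ = m.withDensityᵥ d) {φ : Plane → ℝ} (hφ : IsTestFunction φ) :
    (∫ p, partialDeriv 0 φ p * s₀ p ∂m) + (∫ p, partialDeriv 1 φ p * s₁ p ∂m)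
      = - ∫ p, φ p * d p ∂m := by
  obtain ⟨B, hB⟩ := hφ.exists_bound
  obtain ⟨B₀, hB₀⟩ := hφ.exists_bound_partialDeriv 0
  obtain ⟨B₁, hB₁⟩ := hφ.exists_bound_partialDeriv 1
  have := h φ hφ
  rwa [e₀, e₁, ed,
    integral_withDensityᵥ hs₀ (hφ.continuous_partialDeriv 0).measurable hB₀,
    integral_withDensityᵥ hs₁ (hφ.continuous_partialDeriv 1).measurable hB₁,
    integral_withDensityᵥ hd hφ.1.continuous.measurable hB] at this

theorem integral_abs_density_le {m : Measure Plane} {S : VectorMeasure Plane Plane}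
    [IsFiniteMeasure S.variation] {δ : SignedMeasure Plane} {s₀ s₁ d : Plane → ℝ}
    (hs₀ : Integrable s₀ m) (hs₁ : Integrable s₁ m) (hd : Integrable d m)
    (ms₀ : Measurable s₀) (ms₁ : Measurable s₁) (md : Measurable d)
    (e₀ : comp S 0 = m.withDensityᵥ s₀) (e₁ : comp S 1 = m.withDensityᵥ s₁)
    (ed : δ = m.withDensityᵥ d) :
    ∫ p, (|s₀ p| + |s₁ p| + |d p|) ∂m ≤
      2 * (S.variation.real univ + δ.totalVariation.real univ) := by
  have key : ∀ (i : Fin 2) (f : Plane → ℝ), Integrable f m → Measurable f →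
      comp S i = m.withDensityᵥ f → ∫ p, |f p| ∂m ≤ S.variation.real univ := by
    intro i f hf mf hef
    have h := totalVariation_real_withDensityᵥ hf mf MeasurableSet.univ
    rw [Measure.restrict_univ, ← hef] at h
    rw [← h]
    exact ENNReal.toReal_mono (measure_ne_top _ _) (totalVariation_comp_le S i univ)
  have h0 := key 0 s₀ hs₀ ms₀ e₀
  have h1 := key 1 s₁ hs₁ ms₁ e₁
  have h2 := totalVariation_real_withDensityᵥ hd md MeasurableSet.univ
  rw [Measure.restrict_univ, ← ed] at h2
  rw [integral_add (f := fun p => |s₀ p| + |s₁ p|) (hs₀.abs.add hs₁.abs) hd.abs,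
    integral_add hs₀.abs hs₁.abs, ← h2]
  have := measureReal_nonneg (μ := δ.totalVariation) (s := univ)
  linarith

theorem measure_estimate {S T : VectorMeasure Plane Plane} {divS divT : SignedMeasure Plane}
    {χ : Plane → ℝ} (hSf : IsFiniteMeasure S.variation) (hTf : IsFiniteMeasure T.variation)
    (hS : HasDivergence S divS) (hT : HasDivergence T divT) (hS0 : 0 ≤ comp S 0)
    (hT1 : 0 ≤ comp T 1) (hχ : Measurable χ) (hχ01 : ∀ p, χ p ∈ Icc (0 : ℝ) 1)
    (hb : Bornology.IsBounded (Function.support χ)) :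
    (∫ᵛ p, χ p ∂<•(minMeas (posMeas (comp S 0 - absMeas (comp S 1)))
        (posMeas (comp T 1 - absMeas (comp T 0))))) ≤
      36 * (eLpNorm χ 2 volume).toReal
          * √(S.variation.real univ + divS.totalVariation.real univ)
          * √(T.variation.real univ + divT.totalVariation.real univ) +
        (36 * divS.totalVariation.real univ + 36 * divT.totalVariation.real univ +
          negMeas (comp S 0 - absMeas (comp S 1)) univ +
          negMeas (comp T 1 - absMeas (comp T 0)) univ) := by
  obtain ⟨m, hmf, l₁, l₂, l₃, l₄, l₅, l₆⟩ : ∃ m : Measure Plane, IsFiniteMeasure m ∧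
      (comp S 0).totalVariation ≤ m ∧ (comp S 1).totalVariation ≤ m ∧ divS.totalVariation ≤ m ∧
      (comp T 0).totalVariation ≤ m ∧ (comp T 1).totalVariation ≤ m ∧
      divT.totalVariation ≤ m := by
    refine ⟨S.variation + T.variation + divS.totalVariation + divT.totalVariation,
      inferInstance, ?_⟩
    have hle : ∀ a b c d : Measure Plane, a ≤ a + b + c + d ∧ b ≤ a + b + c + d ∧
        c ≤ a + b + c + d ∧ d ≤ a + b + c + d := fun a b c d =>
      ⟨((Measure.le_add_right le_rfl).trans (Measure.le_add_right le_rfl)).trans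
        (Measure.le_add_right le_rfl),
      ((Measure.le_add_left le_rfl).trans (Measure.le_add_right le_rfl)).trans
        (Measure.le_add_right le_rfl),
      (Measure.le_add_left le_rfl).trans (Measure.le_add_right le_rfl),
      Measure.le_add_left le_rfl⟩
    obtain ⟨h1, h2, h3, h4⟩ :=
      hle S.variation T.variation divS.totalVariation divT.totalVariation
    exact ⟨(totalVariation_comp_le S 0).trans h1, (totalVariation_comp_le S 1).trans h1, h3,
      (totalVariation_comp_le T 0).trans h2, (totalVariation_comp_le T 1).trans h2, h4⟩
  -- all the measures involved have densities with respect to `m`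
  obtain ⟨s₀, ms₀, hs₀, es₀⟩ := exists_density l₁
  obtain ⟨s₁, ms₁, hs₁, es₁⟩ := exists_density l₂
  obtain ⟨d, md, hd, ed⟩ := exists_density l₃
  obtain ⟨t₀, mt₀, ht₀, et₀⟩ := exists_density l₄
  obtain ⟨t₁, mt₁, ht₁, et₁⟩ := exists_density l₅
  obtain ⟨e, me, he, ee⟩ := exists_density l₆
  have hs : 0 ≤ᵐ[m] s₀ := ae_nonneg_of_withDensityᵥ_nonneg hs₀ (es₀ ▸ hS0)
  have ht : 0 ≤ᵐ[m] t₁ := ae_nonneg_of_withDensityᵥ_nonneg ht₁ (et₁ ▸ hT1)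
  have key := plane_density_estimate hs₀ hs₁ hd ht₀ ht₁ he hs ht
    (fun φ hφ => hasDivergence_withDensityᵥ hS hs₀ hs₁ hd es₀ es₁ ed hφ)
    (fun φ hφ => hasDivergence_withDensityᵥ hT ht₀ ht₁ he et₀ et₁ ee hφ) hχ hχ01 hb
    (integral_abs_density_le hs₀ hs₁ hd ms₀ ms₁ md es₀ es₁ ed)
    (integral_abs_density_le ht₀ ht₁ he mt₀ mt₁ me et₀ et₁ ee)
  have hdiff : ∀ {f g : Plane → ℝ}, Integrable f m → Integrable g m → Measurable g →
      m.withDensityᵥ f - absMeas (m.withDensityᵥ g) = m.withDensityᵥ fun p => f p - |g p| := by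
    intro f g hf hg mg
    rw [absMeas_withDensityᵥ hg mg]
    exact (withDensityᵥ_sub hf hg.abs).symm
  have hu : Integrable (fun p => s₀ p - |s₁ p|) m := hs₀.sub hs₁.abs
  have hv : Integrable (fun p => t₁ p - |t₀ p|) m := ht₁.sub ht₀.abs
  have mu : Measurable fun p => s₀ p - |s₁ p| := ms₀.sub ms₁.abs
  have mv : Measurable fun p => t₁ p - |t₀ p| := mt₁.sub mt₀.abs
  have hu' : Integrable (fun p => (s₀ p - |s₁ p|)⁺) m := hu.pos_part
  have hv' : Integrable (fun p => (t₁ p - |t₀ p|)⁺) m := hv.pos_part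
  have hu'' : Integrable (fun p => (s₀ p - |s₁ p|)⁻) m := hu.neg_part
  have hv'' : Integrable (fun p => (t₁ p - |t₀ p|)⁻) m := hv.neg_part
  have mu' : Measurable fun p => (s₀ p - |s₁ p|)⁺ := mu.max measurable_const
  have mv' : Measurable fun p => (t₁ p - |t₀ p|)⁺ := mv.max measurable_const
  have hmin : Integrable (fun p => min ((s₀ p - |s₁ p|)⁺) ((t₁ p - |t₀ p|)⁺)) m := hu'.inf hv'
  have hχ1 : ∀ p, |χ p| ≤ 1 := fun p => by
    rw [abs_of_nonneg (hχ01 p).1]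
    exact (hχ01 p).2
  subst ed ee
  rw [totalVariation_real_withDensityᵥ hd md MeasurableSet.univ,
    totalVariation_real_withDensityᵥ he me MeasurableSet.univ] at key ⊢
  rw [es₀, es₁, et₀, et₁, hdiff hs₀ hs₁ ms₁, hdiff ht₁ ht₀ mt₀, posMeas_withDensityᵥ hu mu,
    posMeas_withDensityᵥ hv mv, minMeas_withDensityᵥ hu' mu' hv' mv',
    integral_withDensityᵥ hmin hχ hχ1, negMeas_withDensityᵥ hu mu,
    negMeas_withDensityᵥ hv mv, withDensityᵥ_apply hu'' MeasurableSet.univ,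
    withDensityᵥ_apply hv'' MeasurableSet.univ]
  simp only [Measure.restrict_univ] at key ⊢
  refine key.trans (le_of_eq ?_)
  ring

end PlaneFields

end

theorem theorem3p1 :
    ∃ C : ℝ, 0 < C ∧
      -- Sobolev vector fields
      (∀ (S T : PlaneFields.Plane → PlaneFields.Plane) (χ : PlaneFields.Plane → ℝ),
        PlaneFields.MemW11 S → PlaneFields.MemW11 T →
        (∀ᵐ p, 0 ≤ S p 0) → (∀ᵐ p, 0 ≤ T p 1) →
        Measurable χ → (∀ p, χ p ∈ Set.Icc (0 : ℝ) 1) →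
        Bornology.IsBounded (Function.support χ) →
        ∫ p, χ p * min ((S p 0 - |S p 1|)⁺) ((T p 1 - |T p 0|)⁺)
          ≤ C * (eLpNorm χ 2 volume).toReal
              * √(∫ p, (‖S p‖ + |PlaneFields.weakDiv S p|))
              * √(∫ p, (‖T p‖ + |PlaneFields.weakDiv T p|))
            + ∫ p, (C * |PlaneFields.weakDiv S p| + C * |PlaneFields.weakDiv T p|
                + (S p 0 - |S p 1|)⁻ + (T p 1 - |T p 0|)⁻)) ∧
      -- vector-valued measures with finite total variation
      (∀ (S T : VectorMeasure PlaneFields.Plane PlaneFields.Plane)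
        (divS divT : SignedMeasure PlaneFields.Plane) (χ : PlaneFields.Plane → ℝ),
        IsFiniteMeasure S.variation → IsFiniteMeasure T.variation →
        PlaneFields.HasDivergence S divS → PlaneFields.HasDivergence T divT →
        0 ≤ PlaneFields.comp S 0 → 0 ≤ PlaneFields.comp T 1 →
        Measurable χ → (∀ p, χ p ∈ Set.Icc (0 : ℝ) 1) →
        Bornology.IsBounded (Function.support χ) →
        (∫ᵛ p, χ p ∂<•(PlaneFields.minMeas
            (PlaneFields.posMeas
              (PlaneFields.comp S 0 - PlaneFields.absMeas (PlaneFields.comp S 1)))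
            (PlaneFields.posMeas
              (PlaneFields.comp T 1 - PlaneFields.absMeas (PlaneFields.comp T 0)))))
          ≤ C * (eLpNorm χ 2 volume).toReal
              * √(S.variation.real Set.univ + divS.totalVariation.real Set.univ)
              * √(T.variation.real Set.univ + divT.totalVariation.real Set.univ)
            + (C * divS.totalVariation.real Set.univ + C * divT.totalVariation.real Set.univ
              + PlaneFields.negMeas
                  (PlaneFields.comp S 0 - PlaneFields.absMeas (PlaneFields.comp S 1)) Set.univ
              + PlaneFields.negMeas
                  (PlaneFields.comp T 1 - PlaneFields.absMeas (PlaneFields.comp T 0))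
                  Set.univ)) := by
  refine ⟨36, by norm_num, ?_, ?_⟩
  · intro S T χ hS hT hS0 hT1 hχ hχ01 hb
    exact PlaneFields.sobolev_estimate hS hT hS0 hT1 hχ hχ01 hb
  · intro S T divS divT χ hSf hTf hS hT hS0 hT1 hχ hχ01 hb
    exact PlaneFields.measure_estimate hSf hTf hS hT hS0 hT1 hχ hχ01 hb
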